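/- **Theorem B.** Let $K>0$ and let $$\mathcal C_K=\{(w,z)\in\mathbb C^2 : e^{-K}<s<e^{K}\ \text{for } s=|w|,\,|z|,\,|wz|\},\qquad \Delta_s(w)=\tfrac12\left(w-\tfrac1w\right).$$ Let $M$ be a holomorphic function on $\mathcal C_K$ such that $M(w,z)=M(z,w)$ and $$M(w,z)\,\Delta_s\!\left(\tfrac1{wz}\right)+M\!\left(z,\tfrac1{wz}\right)\Delta_s(w)+M\!\left(\tfrac1{wz},w\right)\Delta_s(z)=0$$ for all $(w,z)\in\mathcal C_K$. For integers $n\ge1$ and $|i|\le n-1$ let $L_{ni}$ be given by $$L_{n,\,n-1-2j}=w^nz^{n-1-j}+\frac{w^j}{z^{n-1-j}}+\frac1{w^nz^j}+(w\leftrightarrow z)\qquad(0\le j\le n-1),$$ $$L_{n,\,n-2j}=w^{n-1}z^{n-j}+\frac{w^j}{z^{n-j}}+\frac1{w^{n-1}z^j}+(w\leftrightarrow z)\qquad(1\le j\le n-1),$$ where $(w\leftrightarrow z)$ stands for the three preceding terms with $w$ and $z$ interchanged. Then there are complex numbers $\alpha_{ni}$ $(n\ge1,\ |i|\le n-1)$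 with $$M=\sum_{n=1}^{\infty}\ \sum_{i=-n+1}^{n-1}\alpha_{ni}L_{ni}\quad\text{on }\mathcal C_K,$$ where the series converges absolutely and uniformly on every compact subset of $\mathcal C_K$ (that is, both $\sum_n\sum_i\alpha_{ni}L_{ni}$ and $\sum_n\sum_i|\alpha_{ni}L_{ni}|$ converge uniformly there), and for every $K'$ with $0<K'<K$ there is a constant $C'>0$ such that $|\alpha_{ni}|\le C'e^{-K'n}$ for all $n\ge1$, $|i|\le n-1$. The coefficients are unique: if $\beta_{ni}$ are complex numbers for which $\sum_{n=1}^{\infty}\bigl(\sum_{i=-n+1}^{n-1}\beta_{ni}L_{ni}\bigr)$ converges to $M$ uniformly on every compact subset of $\mathcal C_K$, then $\beta_{ni}=\alpha_{ni}$ for all $n\ge1$, $|i|\le n-1$. -/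

import Mathlib

open Filter

noncomputable section

/-- The cyclic invariant annulus `C_K`: the pairs `(w, z)` with
`e^{-K} < s < e^K` for `s = |w|, |z|, |wz|`. -/
def cyclicAnnulus (K : ℝ) : Set (ℂ × ℂ) :=
  {p | (Real.exp (-K) < ‖p.1‖ ∧ ‖p.1‖ < Real.exp K) ∧
       (Real.exp (-K) < ‖p.2‖ ∧ ‖p.2‖ < Real.exp K) ∧
       (Real.exp (-K) < ‖p.1 * p.2‖ ∧ ‖p.1 * p.2‖ < Real.exp K)}

/-- The naive symmetric difference operator `Δ_s(w) = (w - 1/w) / 2`. -/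
def naiveDelta (w : ℂ) : ℂ := (w - 1 / w) / 2

/-- The cyclic Leibniz rule on `C_K`, for a difference operator `Δ`:
`M(w,z) Δ(1/(wz)) + M(z,1/(wz)) Δ(w) + M(1/(wz),w) Δ(z) = 0`. -/
def CyclicLeibnizRule (Δ : ℂ → ℂ) (K : ℝ) (M : ℂ × ℂ → ℂ) : Prop :=
  ∀ w z : ℂ, (w, z) ∈ cyclicAnnulus K →
    M (w, z) * Δ (1 / (w * z)) + M (z, 1 / (w * z)) * Δ w + M (1 / (w * z), w) * Δ z = 0

/-- The solution space `M⁺(Δ, C_K)`: the holomorphic functions on `C_K` that are symmetric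
under `w ↔ z` and satisfy the cyclic Leibniz rule with `Δ`. The values of `M` outside `C_K`
play no role. -/
def symmetricSolutions (Δ : ℂ → ℂ) (K : ℝ) : Set (ℂ × ℂ → ℂ) :=
  {M | DifferentiableOn ℂ M (cyclicAnnulus K) ∧
       (∀ w z : ℂ, (w, z) ∈ cyclicAnnulus K → M (w, z) = M (z, w)) ∧
       CyclicLeibnizRule Δ K M}

/-- Half of the minimal solution of the first type:
`w^n z^{n-1-j} + w^j / z^{n-1-j} + 1 / (w^n z^j)`. -/
def minimalHalfOne (n j : ℤ) (w z : ℂ) : ℂ :=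
  w ^ n * z ^ (n - 1 - j) + w ^ j / z ^ (n - 1 - j) + 1 / (w ^ n * z ^ j)

/-- Half of the minimal solution of the second type:
`w^{n-1} z^{n-j} + w^j / z^{n-j} + 1 / (w^{n-1} z^j)`. -/
def minimalHalfTwo (n j : ℤ) (w z : ℂ) : ℂ :=
  w ^ (n - 1) * z ^ (n - j) + w ^ j / z ^ (n - j) + 1 / (w ^ (n - 1) * z ^ j)

/-- The minimal solution `L_{n,i}` (`n ≥ 1`, `|i| ≤ n - 1`). It is of the first type, with
`i = n - 1 - 2j`, if `n - i` is odd, and of the second type, with `i = n - 2j`, if `n - i` is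
even; in both cases the half above is symmetrized by adding the term with `w ↔ z`. -/
def minimalSolution (n : ℕ) (i : ℤ) (p : ℂ × ℂ) : ℂ :=
  if Odd ((n : ℤ) - i) then
    minimalHalfOne n (((n : ℤ) - 1 - i) / 2) p.1 p.2 +
      minimalHalfOne n (((n : ℤ) - 1 - i) / 2) p.2 p.1
  else
    minimalHalfTwo n (((n : ℤ) - i) / 2) p.1 p.2 +
      minimalHalfTwo n (((n : ℤ) - i) / 2) p.2 p.1

theorem minimalSolution_typeOne (n : ℕ) (j : ℤ) (p : ℂ × ℂ) :
    minimalSolution n ((n : ℤ) - 1 - 2 * j) p =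
      minimalHalfOne n j p.1 p.2 + minimalHalfOne n j p.2 p.1 := by
  have h1 : Odd ((n : ℤ) - ((n : ℤ) - 1 - 2 * j)) := ⟨j, by ring⟩
  have h2 : ((n : ℤ) - 1 - ((n : ℤ) - 1 - 2 * j)) / 2 = j := by omega
  rw [minimalSolution, if_pos h1, h2]

theorem minimalSolution_typeTwo (n : ℕ) (j : ℤ) (p : ℂ × ℂ) :
    minimalSolution n ((n : ℤ) - 2 * j) p =
      minimalHalfTwo n j p.1 p.2 + minimalHalfTwo n j p.2 p.1 := by
  have h1 : ¬ Odd ((n : ℤ) - ((n : ℤ) - 2 * j)) := by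
    rw [Int.not_odd_iff_even]; exact ⟨j, by ring⟩
  have h2 : ((n : ℤ) - ((n : ℤ) - 2 * j)) / 2 = j := by omega
  rw [minimalSolution, if_neg h1, h2]

/-- The partial sum `∑_{n=1}^{N} ∑_{i=-n+1}^{n-1} α_{ni} L_{ni}`. -/
def minimalPartialSum (α : ℕ → ℤ → ℂ) (N : ℕ) (p : ℂ × ℂ) : ℂ :=
  ∑ n ∈ Finset.Icc 1 N, ∑ i ∈ Finset.Icc (-(n : ℤ) + 1) ((n : ℤ) - 1),
    α n i * minimalSolution n i p

/-- The partial sum `∑_{n=1}^{N} ∑_{i=-n+1}^{n-1} |α_{ni} L_{ni}|` of the absolute values of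
all the terms. -/
def minimalPartialAbsSum (α : ℕ → ℤ → ℂ) (N : ℕ) (p : ℂ × ℂ) : ℝ :=
  ∑ n ∈ Finset.Icc 1 N, ∑ i ∈ Finset.Icc (-(n : ℤ) + 1) ((n : ℤ) - 1),
    ‖α n i * minimalSolution n i p‖

/-- `M = ∑_{n=1}^{∞} ∑_{i=-n+1}^{n-1} α_{ni} L_{ni}`, uniformly on every compact subset
of `C_K`. -/
def MinimalSeriesConverges (K : ℝ) (α : ℕ → ℤ → ℂ) (M : ℂ × ℂ → ℂ) : Prop :=
  ∀ S : Set (ℂ × ℂ), S ⊆ cyclicAnnulus K → IsCompact S →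
    TendstoUniformlyOn (minimalPartialSum α) M atTop S

/-- The series `∑_{n=1}^{∞} ∑_{i=-n+1}^{n-1} |α_{ni} L_{ni}|` converges uniformly on every
compact subset of `C_K`. -/
def MinimalSeriesAbsConverges (K : ℝ) (α : ℕ → ℤ → ℂ) : Prop :=
  ∀ S : Set (ℂ × ℂ), S ⊆ cyclicAnnulus K → IsCompact S →
    ∃ g : ℂ × ℂ → ℝ, TendstoUniformlyOn (minimalPartialAbsSum α) g atTop S

end

/-! The annulus consists of the points for which (log |w|, log |z|) lies in an open hexagon. On
exponents the dual gauge is max(|m|, |n|, |m - n|), called `hexNorm`. The function M is the sum of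
its Laurent series, and Cauchy estimates at the vertices of slightly smaller hexagons bound the
coefficients a(p) by a constant times e^{-K' hexNorm p} for every 0 < K' < K
(`exists_norm_laurentCoeff_le`). The Leibniz rule becomes a linear recurrence for a
(`laurentCoeff_cyclicLeibniz`).

A minimal solution of level n has six monomials, counted with multiplicity, on the hexagons of
radius n and n - 1. Let P and Q denote the coefficients of the solutions of the first and the second
type. Comparing Laurent coefficients on two kinds of sides gives a(n, b) = P(n, b) + Q(n+1, b) and
a(n-b, -b) = Q(n, b) + P(n+1, b). The solution that decays in n is an alternating sum of the a's.
The comparison on a third kind of side, (b-n, -n), is then automatic: by the recurrence and the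
symmetry its defect is 2-periodic in n, and it decays, so it vanishes (`coeff_left`). The same
principle proves the identity `coeffOne_eq_coeffTwo`, needed at the corners.

Hence the sum of a(p) w^m z^n over one hexagon is the outer part of one block of the series plus the
inner part of the next. Partial sums of the series differ from Laurent partial sums over hexagons by
one outer block, which tends to 0 (`sum_blocks_eq`). The Weierstrass test makes the convergence
absolute and locally uniform.

For uniqueness, each minimal solution contains an inner monomial that occurs in no other one of the
same or a higher level (`exists_minimalSolution_dual`), so its coefficient can be read off by
induction on the level. -/

/-! ### The annulus and mean values over tori. -/

theorem isOpen_cyclicAnnulus (K : ℝ) : IsOpen (cyclicAnnulus K) := by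
  have h1 : Continuous fun p : ℂ × ℂ => ‖p.1‖ := by fun_prop
  have h2 : Continuous fun p : ℂ × ℂ => ‖p.2‖ := by fun_prop
  have h3 : Continuous fun p : ℂ × ℂ => ‖p.1 * p.2‖ := by fun_prop
  have key : ∀ f : ℂ × ℂ → ℝ, Continuous f →
      IsOpen {p | Real.exp (-K) < f p ∧ f p < Real.exp K} := fun f hf =>
    (isOpen_lt continuous_const hf).inter (isOpen_lt hf continuous_const)
  exact (key _ h1).inter ((key _ h2).inter (key _ h3))

theorem cyclicAnnulus_ne_zero {K : ℝ} {q : ℂ × ℂ} (hq : q ∈ cyclicAnnulus K) :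
    q.1 ≠ 0 ∧ q.2 ≠ 0 :=
  ⟨norm_pos_iff.1 ((Real.exp_pos _).trans hq.1.1), norm_pos_iff.1 ((Real.exp_pos _).trans hq.2.1.1)⟩

/-- The average of `g` over the circle of radius `r` centred at `0`. -/
noncomputable def circleMean (g : ℂ → ℂ) (r : ℝ) : ℂ :=
  ∫ θ in (0 : ℝ)..1, g (circleMap 0 r (2 * Real.pi * θ))

theorem circleMean_eq_circleIntegral (g : ℂ → ℂ) {r : ℝ} (hr : r ≠ 0) :
    circleMean g r = (2 * Real.pi * Complex.I)⁻¹ * ∮ z in C(0, r), (z - 0)⁻¹ • g z := by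
  have h : (∮ z in C(0, r), (z - 0)⁻¹ • g z)
      = Complex.I * ∫ θ in (0 : ℝ)..2 * Real.pi, g (circleMap 0 r θ) := by
    rw [circleIntegral, ← intervalIntegral.integral_const_mul]
    congr 1
    ext θ
    have : circleMap 0 r θ ≠ 0 := by simpa using circleMap_ne_center (c := 0) (θ := θ) hr
    simp only [deriv_circleMap, smul_eq_mul, sub_zero]
    field_simp
  have h2 := intervalIntegral.integral_comp_mul_left (a := 0) (b := 1)
    (fun θ => g (circleMap 0 r θ)) (c := 2 * Real.pi) (by positivity)
  rw [circleMean, h2, h]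
  have hpi : (Real.pi : ℂ) ≠ 0 := by exact_mod_cast Real.pi_ne_zero
  simp only [mul_zero, mul_one, Complex.real_smul]
  push_cast
  field_simp

theorem circleMean_eq_of_differentiable_annulus {g : ℂ → ℂ} {r s : ℝ} (hr : 0 < r) (hs : 0 < s)
    (hg : ∀ z : ℂ, min r s ≤ ‖z‖ → ‖z‖ ≤ max r s → DifferentiableAt ℂ g z) :
    circleMean g r = circleMean g s := by
  wlog h : s ≤ r generalizing r s
  · exact (this hs hr (by simpa only [min_comm, max_comm] using hg) (le_of_not_ge h)).symm
  rw [min_eq_right h, max_eq_left h] at hg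
  rw [circleMean_eq_circleIntegral g hr.ne', circleMean_eq_circleIntegral g hs.ne',
    Complex.circleIntegral_sub_center_inv_smul_eq_of_differentiable_on_annulus_off_countable hs h
      Set.countable_empty]
  · intro z hz
    simp only [Set.mem_sdiff, mem_closedBall_zero_iff, mem_ball_zero_iff, not_lt] at hz
    exact (hg z hz.2 hz.1).continuousAt.continuousWithinAt
  · intro z hz
    simp only [Set.mem_sdiff, mem_closedBall_zero_iff, mem_ball_zero_iff, not_le] at hz
    exact hg z hz.1.2.le hz.1.1.le

/-- The average of `g` over the torus of radii `r`, `s`. -/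
noncomputable def torusMean (g : ℂ × ℂ → ℂ) (r s : ℝ) : ℂ :=
  ∫ θ in (0 : ℝ)..1, ∫ φ in (0 : ℝ)..1,
    g (circleMap 0 r (2 * Real.pi * θ), circleMap 0 s (2 * Real.pi * φ))

theorem continuous_torus_comp {g : ℂ × ℂ → ℂ} {r s : ℝ}
    (hg : ∀ q : ℂ × ℂ, ‖q.1‖ = |r| → ‖q.2‖ = |s| → ContinuousAt g q) :
    Continuous fun x : ℝ × ℝ =>
      g (circleMap 0 r (2 * Real.pi * x.1), circleMap 0 s (2 * Real.pi * x.2)) := by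
  rw [continuous_iff_continuousAt]
  intro x
  refine ContinuousAt.comp (f := fun x : ℝ × ℝ =>
    (circleMap 0 r (2 * Real.pi * x.1), circleMap 0 s (2 * Real.pi * x.2))) ?_ ?_
  · exact hg _ (by simp) (by simp)
  · refine Continuous.continuousAt ?_
    have := continuous_circleMap (0 : ℂ) r
    have := continuous_circleMap (0 : ℂ) s
    fun_prop

theorem torusMean_swap {g : ℂ × ℂ → ℂ} {r s : ℝ}
    (hg : ∀ q : ℂ × ℂ, ‖q.1‖ = |r| → ‖q.2‖ = |s| → ContinuousAt g q) :
    torusMean g r s = ∫ φ in (0 : ℝ)..1, ∫ θ in (0 : ℝ)..1,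
      g (circleMap 0 r (2 * Real.pi * θ), circleMap 0 s (2 * Real.pi * φ)) := by
  rw [torusMean, MeasureTheory.intervalIntegral_intervalIntegral_swap]
  have h := continuous_torus_comp hg
  exact (h.continuousOn.integrableOn_compact
    (isCompact_uIcc.prod isCompact_uIcc)).mono_set
      (Set.prod_mono Set.uIoc_subset_uIcc Set.uIoc_subset_uIcc)

/-- Cauchy's theorem in one variable at a time: the first radius moves from r to 1, then the second
from s to 1. The radii stay admissible since |w| s remains between rs and s, and both of these are
allowed values. -/
theorem torusMean_eq_torusMean_one {K : ℝ} (hK : 0 < K) {g : ℂ × ℂ → ℂ}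
    (hg : DifferentiableOn ℂ g (cyclicAnnulus K)) {r s : ℝ} (hr : 0 < r) (hs : 0 < s)
    (hrs : ((r : ℂ), (s : ℂ)) ∈ cyclicAnnulus K) :
    torusMean g r s = torusMean g 1 1 := by
  have hd : ∀ q ∈ cyclicAnnulus K, DifferentiableAt ℂ g q := fun q hq =>
    hg.differentiableAt ((isOpen_cyclicAnnulus K).mem_nhds hq)
  obtain ⟨⟨h1, h2⟩, ⟨h3, h4⟩, h5, h6⟩ := hrs
  simp only [norm_mul, Complex.norm_real, Real.norm_eq_abs, abs_of_pos hr, abs_of_pos hs]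
    at h1 h2 h3 h4 h5 h6
  have e1 : 1 < Real.exp K := Real.one_lt_exp_iff.2 hK
  have e2 : Real.exp (-K) < 1 := by simpa using hK
  have step1 : torusMean g r s = torusMean g 1 s := by
    rw [torusMean_swap, torusMean_swap]
    · refine intervalIntegral.integral_congr fun φ _ => ?_
      refine circleMean_eq_of_differentiable_annulus
        (g := fun w => g (w, circleMap 0 s (2 * Real.pi * φ))) hr one_pos fun w hw1 hw2 => ?_
      have hmem : (w, circleMap 0 s (2 * Real.pi * φ)) ∈ cyclicAnnulus K := by
        have hn : ‖circleMap 0 s (2 * Real.pi * φ)‖ = s := by simp [abs_of_pos hs]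
        have hl : min (r * s) s ≤ ‖w‖ * s := by
          rcases min_le_iff.1 hw1 with h | h
          · exact (min_le_left _ _).trans (by gcongr)
          · exact (min_le_right _ _).trans (by nlinarith)
        have hu : ‖w‖ * s ≤ max (r * s) s := by
          rcases le_max_iff.1 hw2 with h | h
          · exact le_max_of_le_left (by gcongr)
          · exact le_max_of_le_right (by nlinarith)
        refine ⟨⟨?_, ?_⟩, ⟨?_, ?_⟩, ?_, ?_⟩ <;> simp only [norm_mul, hn]
        · exact (lt_min h1 e2).trans_le hw1
        · exact hw2.trans_lt (max_lt h2 e1)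
        · exact h3
        · exact h4
        · exact (lt_min h5 h3).trans_le hl
        · exact hu.trans_lt (max_lt h6 h4)
      exact (hd _ hmem).comp (f := fun w => (w, circleMap 0 s (2 * Real.pi * φ))) w (by fun_prop)
    · intro q hq1 hq2
      refine (hd q ?_).continuousAt
      rw [abs_of_pos hs] at hq2
      rw [abs_one] at hq1
      refine ⟨⟨?_, ?_⟩, ⟨?_, ?_⟩, ?_, ?_⟩ <;> simp only [norm_mul, hq1, hq2, one_mul] <;> assumption
    · intro q hq1 hq2
      refine (hd q ?_).continuousAt
      rw [abs_of_pos hs] at hq2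
      rw [abs_of_pos hr] at hq1
      refine ⟨⟨?_, ?_⟩, ⟨?_, ?_⟩, ?_, ?_⟩ <;> simp only [norm_mul, hq1, hq2] <;> assumption
  rw [step1]
  refine intervalIntegral.integral_congr fun θ _ => ?_
  refine circleMean_eq_of_differentiable_annulus
    (g := fun z => g (circleMap 0 1 (2 * Real.pi * θ), z)) hs one_pos fun z hz1 hz2 => ?_
  have hmem : (circleMap 0 1 (2 * Real.pi * θ), z) ∈ cyclicAnnulus K := by
    have hn : ‖circleMap 0 1 (2 * Real.pi * θ)‖ = 1 := by simp
    have hl := (lt_min h3 e2).trans_le hz1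
    have hu := hz2.trans_lt (max_lt h4 e1)
    refine ⟨⟨?_, ?_⟩, ⟨?_, ?_⟩, ?_, ?_⟩ <;> simp only [norm_mul, hn, one_mul] <;> assumption
  exact (hd _ hmem).comp (f := fun z => (circleMap 0 1 (2 * Real.pi * θ), z)) z (by fun_prop)

theorem norm_torusMean_le {g : ℂ × ℂ → ℂ} {r s B : ℝ} (hr : 0 ≤ r) (hs : 0 ≤ s)
    (hg : ∀ q : ℂ × ℂ, ‖q.1‖ = r → ‖q.2‖ = s → ‖g q‖ ≤ B) : ‖torusMean g r s‖ ≤ B := by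
  have key : ∀ (f : ℝ → ℂ), (∀ x, ‖f x‖ ≤ B) → ‖∫ x in (0 : ℝ)..1, f x‖ ≤ B := fun f hf => by
    simpa using intervalIntegral.norm_integral_le_of_norm_le_const (a := 0) (b := 1)
      (fun x _ => hf x)
  exact key _ fun θ => key _ fun φ => hg _ (by simp [abs_of_nonneg hr]) (by simp [abs_of_nonneg hs])

/-! ### Laurent coefficients and Fourier series on tori. -/

/-- The Laurent monomial `w ^ p.1 * z ^ p.2`. -/
noncomputable def laurentMonomial (p : ℤ × ℤ) (q : ℂ × ℂ) : ℂ := q.1 ^ p.1 * q.2 ^ p.2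

/-- The Laurent coefficients of a function near the unit torus. -/
noncomputable def laurentCoeff (M : ℂ × ℂ → ℂ) (p : ℤ × ℤ) : ℂ :=
  torusMean (fun q => M q * laurentMonomial (-p) q) 1 1

/-- The point with angles `t` on the torus of radii `r`, `s`. -/
noncomputable def torusPoint (r s : ℝ) (t : UnitAddTorus (Fin 2)) : ℂ × ℂ :=
  (r * (AddCircle.toCircle (t 0) : ℂ), s * (AddCircle.toCircle (t 1) : ℂ))

theorem norm_unitAddCircle_toCircle (x : UnitAddCircle) :
    ‖(AddCircle.toCircle x : ℂ)‖ = 1 := Circle.norm_coe _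

theorem continuous_torusPoint (r s : ℝ) : Continuous (torusPoint r s) := by
  have h : Continuous fun x : UnitAddCircle => (AddCircle.toCircle x : ℂ) :=
    continuous_subtype_val.comp AddCircle.continuous_toCircle
  have h0 := h.comp (continuous_apply (0 : Fin 2) : Continuous fun t : UnitAddTorus (Fin 2) => t 0)
  have h1 := h.comp (continuous_apply (1 : Fin 2) : Continuous fun t : UnitAddTorus (Fin 2) => t 1)
  exact (continuous_const.mul h0).prodMk (continuous_const.mul h1)

theorem torusPoint_coe (r s : ℝ) (x : Fin 2 → ℝ) :
    torusPoint r s (fun i => (x i : UnitAddCircle)) =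
      (circleMap 0 r (2 * Real.pi * x 0), circleMap 0 s (2 * Real.pi * x 1)) := by
  simp [torusPoint, circleMap, AddCircle.toCircle_apply_mk, Circle.coe_exp]

theorem exists_torusPoint_eq (q : ℂ × ℂ) : ∃ t, torusPoint ‖q.1‖ ‖q.2‖ t = q := by
  refine ⟨fun i => (((![q.1.arg, q.2.arg] i) / (2 * Real.pi) : ℝ) : UnitAddCircle), ?_⟩
  have h2 : 2 * Real.pi ≠ 0 := by positivity
  rw [torusPoint_coe _ _ (fun i => ![q.1.arg, q.2.arg] i / (2 * Real.pi))]
  ext <;> simp [circleMap, mul_div_cancel₀ _ h2, -Complex.ofReal_mul]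

theorem laurentMonomial_torusPoint (r s : ℝ) (n : Fin 2 → ℤ) (t : UnitAddTorus (Fin 2)) :
    laurentMonomial (n 0, n 1) (torusPoint r s t) =
      ((r : ℂ) ^ n 0 * (s : ℂ) ^ n 1) * UnitAddTorus.mFourier n t := by
  simp [laurentMonomial, torusPoint, UnitAddTorus.mFourier, fourier_apply, AddCircle.toCircle_zsmul,
    mul_zpow]
  ring

/-- On a fixed torus the Laurent series is a Fourier series in the angles; the powers of the radii
are the only difference between the two kinds of coefficients. -/
theorem mFourierCoeff_torusPoint {M : ℂ × ℂ → ℂ} {r s : ℝ} (hr : r ≠ 0) (hs : s ≠ 0)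
    (hM : ∀ q : ℂ × ℂ, ‖q.1‖ = |r| → ‖q.2‖ = |s| → ContinuousAt M q) (n : Fin 2 → ℤ) :
    UnitAddTorus.mFourierCoeff (fun t => M (torusPoint r s t)) n =
      ((r : ℂ) ^ n 0 * (s : ℂ) ^ n 1) *
        torusMean (fun q => M q * laurentMonomial (-(n 0, n 1)) q) r s := by
  set G : ℝ × ℝ → ℂ := fun x => M (circleMap 0 r (2 * Real.pi * x.1), circleMap 0 s (2 * Real.pi * x.2))
    * laurentMonomial (-(n 0, n 1)) (circleMap 0 r (2 * Real.pi * x.1), circleMap 0 s (2 * Real.pi * x.2))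
    with hG
  have hGc : Continuous G := by
    refine continuous_torus_comp (g := fun q => M q * laurentMonomial (-(n 0, n 1)) q)
      fun q h1 h2 => (hM q h1 h2).mul ?_
    have e1 : q.1 ≠ 0 := by rw [← norm_pos_iff, h1]; positivity
    have e2 : q.2 ≠ 0 := by rw [← norm_pos_iff, h2]; positivity
    exact (continuousAt_fst.zpow₀ _ (Or.inl e1)).mul (continuousAt_snd.zpow₀ _ (Or.inl e2))
  have hrs : (r : ℂ) ^ n 0 * (s : ℂ) ^ n 1 ≠ 0 :=
    mul_ne_zero (zpow_ne_zero _ (by exact_mod_cast hr)) (zpow_ne_zero _ (by exact_mod_cast hs))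
  have hfun : ∀ x : Fin 2 → ℝ, UnitAddTorus.mFourier (-n) (fun i => (x i : UnitAddCircle)) •
      M (torusPoint r s fun i => (x i : UnitAddCircle)) =
      ((r : ℂ) ^ n 0 * (s : ℂ) ^ n 1) * G (x 0, x 1) := by
    intro x
    have h := laurentMonomial_torusPoint r s (-n) (fun i => (x i : UnitAddCircle))
    rw [torusPoint_coe] at h
    simp only [hG, torusPoint_coe, smul_eq_mul, Prod.neg_mk, Pi.neg_apply, zpow_neg] at h ⊢
    rw [h]
    have hr' : (r : ℂ) ^ n 0 ≠ 0 := left_ne_zero_of_mul hrs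
    have hs' : (s : ℂ) ^ n 1 ≠ 0 := right_ne_zero_of_mul hrs
    field_simp
  have hset : {x : Fin 2 → ℝ | ∀ i, x i ∈ Set.Ioc ((0 : Fin 2 → ℝ) i) ((0 : Fin 2 → ℝ) i + 1)} =
      MeasurableEquiv.finTwoArrow ⁻¹' (Set.Ioc (0 : ℝ) 1 ×ˢ Set.Ioc (0 : ℝ) 1) := by
    ext x
    simp [Fin.forall_fin_two, MeasurableEquiv.finTwoArrow]
  have hint := (MeasureTheory.volume_preserving_finTwoArrow ℝ).setIntegral_preimage_emb
    (MeasurableEquiv.measurableEmbedding _) G (Set.Ioc (0 : ℝ) 1 ×ˢ Set.Ioc (0 : ℝ) 1)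
  have hprod : ∫ x in Set.Ioc (0 : ℝ) 1 ×ˢ Set.Ioc (0 : ℝ) 1, G x =
      ∫ x in Set.Ioc (0 : ℝ) 1, ∫ y in Set.Ioc (0 : ℝ) 1, G (x, y) := by
    refine MeasureTheory.setIntegral_prod _ ?_
    exact (hGc.continuousOn.integrableOn_compact (isCompact_Icc.prod isCompact_Icc)).mono_set
      (Set.prod_mono Set.Ioc_subset_Icc_self Set.Ioc_subset_Icc_self)
  rw [UnitAddTorus.mFourierCoeff_eq_integral _ _ 0]
  simp_rw [hfun]
  rw [MeasureTheory.integral_const_mul, hset]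
  congr 1
  refine (hint.trans hprod).trans ?_
  simp only [torusMean, intervalIntegral.integral_of_le zero_le_one, hG]

theorem torusPoint_mem_cyclicAnnulus {K : ℝ} {q : ℂ × ℂ} (hq : q ∈ cyclicAnnulus K) {q' : ℂ × ℂ}
    (h1 : ‖q'.1‖ = ‖q.1‖) (h2 : ‖q'.2‖ = ‖q.2‖) : q' ∈ cyclicAnnulus K := by
  simpa only [cyclicAnnulus, Set.mem_ofPred_eq, norm_mul, h1, h2] using hq

theorem differentiableOn_laurentMonomial (K : ℝ) (p : ℤ × ℤ) :
    DifferentiableOn ℂ (laurentMonomial p) (cyclicAnnulus K) := by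
  intro q hq
  have h := cyclicAnnulus_ne_zero hq
  exact ((differentiableAt_fst.zpow (Or.inl h.1)).mul
    (differentiableAt_snd.zpow (Or.inl h.2))).differentiableWithinAt

theorem laurentCoeff_eq_torusMean {K : ℝ} (hK : 0 < K) {M : ℂ × ℂ → ℂ}
    (hM : DifferentiableOn ℂ M (cyclicAnnulus K)) {q : ℂ × ℂ} (hq : q ∈ cyclicAnnulus K)
    (p : ℤ × ℤ) :
    laurentCoeff M p = torusMean (fun q => M q * laurentMonomial (-p) q) ‖q.1‖ ‖q.2‖ := by
  have h := cyclicAnnulus_ne_zero hq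
  refine (torusMean_eq_torusMean_one hK (hM.mul (differentiableOn_laurentMonomial K _))
    (norm_pos_iff.2 h.1) (norm_pos_iff.2 h.2) (torusPoint_mem_cyclicAnnulus hq ?_ ?_)).symm <;> simp

/-- The Cauchy estimate on the torus through q. -/
theorem norm_laurentCoeff_le {K : ℝ} (hK : 0 < K) {M : ℂ × ℂ → ℂ}
    (hM : DifferentiableOn ℂ M (cyclicAnnulus K)) {q : ℂ × ℂ} (hq : q ∈ cyclicAnnulus K)
    {B : ℝ} (hB : ∀ q' : ℂ × ℂ, ‖q'.1‖ = ‖q.1‖ → ‖q'.2‖ = ‖q.2‖ → ‖M q'‖ ≤ B) (p : ℤ × ℤ) :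
    ‖laurentCoeff M p‖ ≤ B * ‖laurentMonomial (-p) q‖ := by
  rw [laurentCoeff_eq_torusMean hK hM hq]
  refine norm_torusMean_le (norm_nonneg _) (norm_nonneg _) fun q' h1 h2 => ?_
  have : ‖laurentMonomial (-p) q'‖ = ‖laurentMonomial (-p) q‖ := by
    simp only [laurentMonomial, norm_mul, norm_zpow, h1, h2]
  rw [norm_mul, this]
  exact mul_le_mul_of_nonneg_right (hB q' h1 h2) (norm_nonneg _)

/-- A continuous function on the torus with summable Fourier coefficients is the pointwise sum of
its Fourier series; this is applied to M on the torus through q. -/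
theorem hasSum_laurentCoeff {K : ℝ} (hK : 0 < K) {M : ℂ × ℂ → ℂ}
    (hM : DifferentiableOn ℂ M (cyclicAnnulus K)) {q : ℂ × ℂ} (hq : q ∈ cyclicAnnulus K)
    (hs : Summable fun p => laurentCoeff M p * laurentMonomial p q) :
    HasSum (fun p => laurentCoeff M p * laurentMonomial p q) (M q) := by
  obtain ⟨t, ht⟩ := exists_torusPoint_eq q
  have h0 := cyclicAnnulus_ne_zero hq
  have hat : ∀ q' : ℂ × ℂ, ‖q'.1‖ = ‖q.1‖ → ‖q'.2‖ = ‖q.2‖ → ContinuousAt M q' := fun q' h1 h2 =>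
    (hM.differentiableAt ((isOpen_cyclicAnnulus K).mem_nhds
      (torusPoint_mem_cyclicAnnulus hq h1 h2))).continuousAt
  let f : C(UnitAddTorus (Fin 2), ℂ) := ⟨fun t => M (torusPoint ‖q.1‖ ‖q.2‖ t), by
    rw [continuous_iff_continuousAt]
    intro t
    refine ContinuousAt.comp (hat _ ?_ ?_) (continuous_torusPoint _ _).continuousAt
    · simp [torusPoint, norm_unitAddCircle_toCircle (t 0)]
    · simp [torusPoint, norm_unitAddCircle_toCircle (t 1)]⟩
  have hc : ∀ n : Fin 2 → ℤ, UnitAddTorus.mFourierCoeff f n =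
      (((‖q.1‖ : ℝ) : ℂ) ^ n 0 * ((‖q.2‖ : ℝ) : ℂ) ^ n 1) * laurentCoeff M (n 0, n 1) := by
    intro n
    rw [laurentCoeff_eq_torusMean hK hM hq]
    exact mFourierCoeff_torusPoint (norm_ne_zero_iff.2 h0.1) (norm_ne_zero_iff.2 h0.2)
      (by simpa using hat) n
  have hmon : ∀ n : Fin 2 → ℤ, UnitAddTorus.mFourierCoeff f n • UnitAddTorus.mFourier n t =
      laurentCoeff M (n 0, n 1) * laurentMonomial (n 0, n 1) q := by
    intro n
    conv_rhs => rw [← ht]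
    rw [laurentMonomial_torusPoint, hc, smul_eq_mul]
    ring
  have hsum : Summable (UnitAddTorus.mFourierCoeff f) := by
    rw [← (finTwoArrowEquiv ℤ).summable_iff] at hs
    refine Summable.of_norm (hs.norm.congr fun n => ?_)
    have h1 : ‖UnitAddTorus.mFourier n t‖ = 1 := by
      simp [UnitAddTorus.mFourier, norm_unitAddCircle_toCircle (n 0 • t 0),
        norm_unitAddCircle_toCircle (n 1 • t 1)]
    have h2 := congrArg norm (hmon n)
    rw [norm_smul, h1, mul_one] at h2
    exact h2.symm
  have := UnitAddTorus.hasSum_mFourier_series_apply_of_summable hsum t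
  simp_rw [hmon] at this
  have hval : f t = M q := by
    change M (torusPoint ‖q.1‖ ‖q.2‖ t) = M q
    rw [ht]
  rw [hval] at this
  exact (finTwoArrowEquiv ℤ).hasSum_iff.1 this

-- Orthogonality of Laurent monomials on the unit torus.

noncomputable local instance : MeasureTheory.MeasureSpace UnitAddCircle := ⟨AddCircle.haarAddCircle⟩

local instance : MeasureTheory.IsProbabilityMeasure
    (MeasureTheory.volume : MeasureTheory.Measure UnitAddCircle) :=
  inferInstanceAs (MeasureTheory.IsProbabilityMeasure AddCircle.haarAddCircle)

/-- The `n`-th Fourier coefficient is a continuous functional on the continuous functions on the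
torus. -/
theorem exists_mFourier_dual (n : Fin 2 → ℤ) : ∃ φ : C(UnitAddTorus (Fin 2), ℂ) →L[ℂ] ℂ,
    ∀ m, φ (UnitAddTorus.mFourier m) = if n = m then 1 else 0 := by
  have ho := UnitAddTorus.orthonormal_mFourier (d := Fin 2)
  rw [orthonormal_iff_ite] at ho
  exact ⟨(innerSL ℂ (UnitAddTorus.mFourierLp 2 n)).comp (ContinuousMap.toLp 2 _ ℂ),
    fun m => ho n m⟩

theorem exists_laurentMonomial_dual (p : ℤ × ℤ) : ∃ φ : C(UnitAddTorus (Fin 2), ℂ) →L[ℂ] ℂ,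
    ∀ (m : ℤ × ℤ) (f : C(UnitAddTorus (Fin 2), ℂ)),
      (∀ t, f t = laurentMonomial m (torusPoint 1 1 t)) → φ f = if p = m then 1 else 0 := by
  obtain ⟨φ, hφ⟩ := exists_mFourier_dual ((finTwoArrowEquiv ℤ).symm p)
  refine ⟨φ, fun m f hf => ?_⟩
  have : f = UnitAddTorus.mFourier ((finTwoArrowEquiv ℤ).symm m) := by
    ext t
    have := laurentMonomial_torusPoint 1 1 ((finTwoArrowEquiv ℤ).symm m) t
    rw [hf t]
    simpa using this
  rw [this, hφ]
  simp only [(finTwoArrowEquiv ℤ).symm.injective.eq_iff]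

theorem norm_laurentMonomial_torusPoint (p : ℤ × ℤ) (t : UnitAddTorus (Fin 2)) :
    ‖laurentMonomial p (torusPoint 1 1 t)‖ = 1 := by
  simp [laurentMonomial, torusPoint, norm_unitAddCircle_toCircle (t 0),
    norm_unitAddCircle_toCircle (t 1)]

theorem continuous_laurentMonomial_torusPoint (p : ℤ × ℤ) :
    Continuous fun t => laurentMonomial p (torusPoint 1 1 t) := by
  have h := continuous_torusPoint 1 1
  exact (h.fst.zpow₀ _ fun t => Or.inl (by simp [torusPoint])).mul
    (h.snd.zpow₀ _ fun t => Or.inl (by simp [torusPoint]))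

/-- Summability makes the series converge in the sup norm on the torus, so a continuous coefficient
functional may be applied term by term. -/
theorem laurent_coeff_eq_zero {c : ℤ × ℤ → ℂ} (hc : Summable c)
    (h : ∀ t, HasSum (fun p => c p * laurentMonomial p (torusPoint 1 1 t)) 0) (p : ℤ × ℤ) :
    c p = 0 := by
  let e : ℤ × ℤ → C(UnitAddTorus (Fin 2), ℂ) := fun p =>
    ⟨fun t => laurentMonomial p (torusPoint 1 1 t), continuous_laurentMonomial_torusPoint p⟩
  have hs : Summable fun p => c p • e p := by
    refine Summable.of_norm_bounded hc.norm fun p => ?_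
    rw [norm_smul]
    refine mul_le_of_le_one_right (norm_nonneg _) ?_
    exact (ContinuousMap.norm_le _ zero_le_one).2 fun t =>
      (norm_laurentMonomial_torusPoint p t).le
  obtain ⟨f, hf⟩ := hs
  have hf0 : f = 0 := by
    ext t
    exact ((ContinuousMap.evalCLM ℂ t).hasSum hf).unique (h t)
  obtain ⟨φ, hφ⟩ := exists_laurentMonomial_dual p
  have h1 := φ.hasSum hf
  have h2 : ∀ m, φ (c m • e m) = if m = p then c p else 0 := by
    intro m
    rw [map_smul, hφ m (e m) fun t => rfl]
    by_cases hm : p = m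
    · simp [hm]
    · simp [hm, Ne.symm hm]
  simp_rw [h2] at h1
  rw [hf0, map_zero] at h1
  exact (hasSum_ite_eq p (c p)).unique h1

/-! ### The hexagonal norm and the decay of Laurent coefficients. -/

/-- The hexagonal norm of an exponent. -/
def hexNorm (p : ℤ × ℤ) : ℕ := max p.1.natAbs (max p.2.natAbs (p.1 - p.2).natAbs)

/-- The hexagonal norm of `(log |w|, log |z|)`. -/
noncomputable def hexSize (q : ℂ × ℂ) : ℝ :=
  max |Real.log ‖q.1‖| (max |Real.log ‖q.2‖| |Real.log ‖q.1‖ + Real.log ‖q.2‖|)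

theorem hexSize_nonneg (q : ℂ × ℂ) : 0 ≤ hexSize q := (abs_nonneg _).trans (le_max_left _ _)

theorem mem_cyclicAnnulus_iff {K : ℝ} {q : ℂ × ℂ} (h1 : q.1 ≠ 0) (h2 : q.2 ≠ 0) :
    q ∈ cyclicAnnulus K ↔ hexSize q < K := by
  have e1 := norm_pos_iff.2 h1
  have e2 := norm_pos_iff.2 h2
  have e3 : 0 < ‖q.1 * q.2‖ := norm_pos_iff.2 (mul_ne_zero h1 h2)
  simp only [cyclicAnnulus, Set.mem_ofPred_eq, hexSize, max_lt_iff, abs_lt,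
    ← Real.lt_log_iff_exp_lt e1, ← Real.log_lt_iff_lt_exp e1, ← Real.lt_log_iff_exp_lt e2,
    ← Real.log_lt_iff_lt_exp e2, ← Real.lt_log_iff_exp_lt e3, ← Real.log_lt_iff_lt_exp e3]
  rw [norm_mul, Real.log_mul e1.ne' e2.ne']

theorem hexSize_lt {K : ℝ} {q : ℂ × ℂ} (hq : q ∈ cyclicAnnulus K) : hexSize q < K :=
  (mem_cyclicAnnulus_iff (cyclicAnnulus_ne_zero hq).1 (cyclicAnnulus_ne_zero hq).2).1 hq

theorem norm_laurentMonomial {q : ℂ × ℂ} (h1 : q.1 ≠ 0) (h2 : q.2 ≠ 0) (p : ℤ × ℤ) :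
    ‖laurentMonomial p q‖ = Real.exp (p.1 * Real.log ‖q.1‖ + p.2 * Real.log ‖q.2‖) := by
  have key : ∀ (x : ℂ) (n : ℤ), x ≠ 0 → ‖x‖ ^ n = Real.exp (n * Real.log ‖x‖) := fun x n hx => by
    rw [← Real.rpow_intCast, Real.rpow_def_of_pos (norm_pos_iff.2 hx), mul_comm]
  rw [laurentMonomial, norm_mul, norm_zpow, norm_zpow, key _ _ h1, key _ _ h2, Real.exp_add]

theorem le_hexNorm (p : ℤ × ℤ) : |(p.1 : ℝ)| ≤ hexNorm p ∧ |(p.2 : ℝ)| ≤ hexNorm p ∧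
    |(p.1 - p.2 : ℝ)| ≤ hexNorm p := by
  have h1 : |p.1| ≤ (hexNorm p : ℤ) := by simp [hexNorm]
  have h2 : |p.2| ≤ (hexNorm p : ℤ) := by simp [hexNorm]
  have h3 : |p.1 - p.2| ≤ (hexNorm p : ℤ) := by simp [hexNorm]
  exact ⟨by exact_mod_cast h1, by exact_mod_cast h2, by exact_mod_cast h3⟩

/-- One half of the duality between the two hexagons. In each sign case mx + ny is a nonnegative
combination of two of ±x, ±y, ±(x + y); for instance m(x + y) + (n - m)y if 0 ≤ m ≤ n. -/
theorem hex_pairing_le {m n x y c N : ℝ} (hx : |x| ≤ c) (hy : |y| ≤ c) (hxy : |x + y| ≤ c)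
    (hm : |m| ≤ N) (hn : |n| ≤ N) (hmn : |m - n| ≤ N) : m * x + n * y ≤ c * N := by
  rw [abs_le] at *
  have hc : 0 ≤ c := by linarith
  rcases le_total 0 m with h1 | h1 <;> rcases le_total 0 n with h2 | h2
  · rcases le_total m n with h3 | h3
    · nlinarith [mul_nonneg h1 (sub_nonneg.2 hxy.2), mul_nonneg (sub_nonneg.2 h3) (sub_nonneg.2 hy.2)]
    · nlinarith [mul_nonneg h2 (sub_nonneg.2 hxy.2), mul_nonneg (sub_nonneg.2 h3) (sub_nonneg.2 hx.2)]
  · nlinarith [mul_nonneg h1 (sub_nonneg.2 hx.2),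
      mul_nonneg (neg_nonneg.2 h2) (neg_le_iff_add_nonneg.1 hy.1)]
  · nlinarith [mul_nonneg h2 (sub_nonneg.2 hy.2),
      mul_nonneg (neg_nonneg.2 h1) (neg_le_iff_add_nonneg.1 hx.1)]
  · rcases le_total m n with h3 | h3
    · nlinarith [mul_nonneg (neg_nonneg.2 h2) (neg_le_iff_add_nonneg.1 hxy.1),
        mul_nonneg (sub_nonneg.2 h3) (neg_le_iff_add_nonneg.1 hx.1)]
    · nlinarith [mul_nonneg (neg_nonneg.2 h1) (neg_le_iff_add_nonneg.1 hxy.1),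
        mul_nonneg (sub_nonneg.2 h3) (neg_le_iff_add_nonneg.1 hy.1)]

theorem norm_laurentMonomial_le {q : ℂ × ℂ} (h1 : q.1 ≠ 0) (h2 : q.2 ≠ 0) (p : ℤ × ℤ) :
    ‖laurentMonomial p q‖ ≤ Real.exp (hexSize q * hexNorm p) := by
  rw [norm_laurentMonomial h1 h2, Real.exp_le_exp]
  obtain ⟨e1, e2, e3⟩ := le_hexNorm p
  exact hex_pairing_le (le_max_left _ _) ((le_max_left _ _).trans (le_max_right _ _))
    ((le_max_right _ _).trans (le_max_right _ _)) e1 e2 e3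

/-- The other half of the duality: the maximum is attained at one of the vertices ±(c, 0), ±(0, c),
±(c, -c). -/
theorem exists_hex_pairing_eq (p : ℤ × ℤ) {c : ℝ} (hc : 0 ≤ c) : ∃ x y : ℝ, |x| ≤ c ∧ |y| ≤ c ∧
    |x + y| ≤ c ∧ p.1 * x + p.2 * y = c * hexNorm p := by
  have hN : (hexNorm p : ℤ) = p.1 ∨ (hexNorm p : ℤ) = -p.1 ∨ (hexNorm p : ℤ) = p.2 ∨
      (hexNorm p : ℤ) = -p.2 ∨ (hexNorm p : ℤ) = p.1 - p.2 ∨ (hexNorm p : ℤ) = -(p.1 - p.2) := by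
    unfold hexNorm; omega
  have hN' : (hexNorm p : ℝ) = p.1 ∨ (hexNorm p : ℝ) = -p.1 ∨ (hexNorm p : ℝ) = p.2 ∨
      (hexNorm p : ℝ) = -p.2 ∨ (hexNorm p : ℝ) = p.1 - p.2 ∨ (hexNorm p : ℝ) = -(p.1 - p.2) := by
    exact_mod_cast hN
  have ha : |c| ≤ c := (abs_of_nonneg hc).le
  have hb : |-c| ≤ c := by rwa [abs_neg]
  rcases hN' with h | h | h | h | h | h <;> rw [h]
  · exact ⟨c, 0, by simpa using ha, by simpa using hc, by simpa using ha, by ring⟩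
  · exact ⟨-c, 0, by simpa using ha, by simpa using hc, by simpa using ha, by ring⟩
  · exact ⟨0, c, by simpa using hc, by simpa using ha, by simpa using ha, by ring⟩
  · exact ⟨0, -c, by simpa using hc, by simpa using ha, by simpa using ha, by ring⟩
  · exact ⟨c, -c, by simpa using ha, by simpa using ha, by simpa using hc, by ring⟩
  · exact ⟨-c, c, by simpa using ha, by simpa using ha, by simpa using hc, by ring⟩

theorem hexSize_congr {q q' : ℂ × ℂ} (h1 : ‖q'.1‖ = ‖q.1‖) (h2 : ‖q'.2‖ = ‖q.2‖) :
    hexSize q' = hexSize q := by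
  rw [hexSize, hexSize, h1, h2]

theorem exists_bound_of_hexSize_le {K K' : ℝ} (h : K' < K) {M : ℂ × ℂ → ℂ}
    (hM : ContinuousOn M (cyclicAnnulus K)) : ∃ B : ℝ, 0 ≤ B ∧
    ∀ q : ℂ × ℂ, q.1 ≠ 0 → q.2 ≠ 0 → hexSize q ≤ K' → ‖M q‖ ≤ B := by
  let T : Set (ℂ × ℂ) := {q | (Real.exp (-K') ≤ ‖q.1‖ ∧ ‖q.1‖ ≤ Real.exp K') ∧
    (Real.exp (-K') ≤ ‖q.2‖ ∧ ‖q.2‖ ≤ Real.exp K') ∧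
    (Real.exp (-K') ≤ ‖q.1 * q.2‖ ∧ ‖q.1 * q.2‖ ≤ Real.exp K')}
  have e1 : Real.exp (-K) < Real.exp (-K') := Real.exp_lt_exp.2 (by linarith)
  have e2 : Real.exp K' < Real.exp K := Real.exp_lt_exp.2 h
  have hTK : T ⊆ cyclicAnnulus K := fun q hq =>
    ⟨⟨e1.trans_le hq.1.1, hq.1.2.trans_lt e2⟩, ⟨e1.trans_le hq.2.1.1, hq.2.1.2.trans_lt e2⟩,
      e1.trans_le hq.2.2.1, hq.2.2.2.trans_lt e2⟩
  have hT : IsCompact T := by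
    refine Metric.isCompact_of_isClosed_isBounded ?_ ?_
    · have key : ∀ f : ℂ × ℂ → ℝ, Continuous f →
          IsClosed {p | Real.exp (-K') ≤ f p ∧ f p ≤ Real.exp K'} := fun f hf =>
        (isClosed_le continuous_const hf).inter (isClosed_le hf continuous_const)
      exact (key (fun p => ‖p.1‖) (by fun_prop)).inter ((key (fun p => ‖p.2‖) (by fun_prop)).inter
        (key (fun p => ‖p.1 * p.2‖) (by fun_prop)))
    · refine (Metric.isBounded_closedBall (x := (0 : ℂ × ℂ)) (r := Real.exp K')).subset fun q hq => ?_
      rw [mem_closedBall_zero_iff, Prod.norm_def]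
      exact max_le hq.1.2 hq.2.1.2
  obtain ⟨B, hB⟩ := hT.exists_bound_of_continuousOn (hM.mono hTK)
  refine ⟨max B 0, le_max_right _ _, fun q h1 h2 hq => (hB q ?_).trans (le_max_left _ _)⟩
  have n1 := norm_pos_iff.2 h1
  have n2 := norm_pos_iff.2 h2
  have n3 : 0 < ‖q.1 * q.2‖ := norm_pos_iff.2 (mul_ne_zero h1 h2)
  simp only [hexSize, max_le_iff, abs_le] at hq
  rw [← Real.log_mul n1.ne' n2.ne', ← norm_mul] at hq
  simpa only [T, Set.mem_ofPred_eq, ← Real.le_log_iff_exp_le n1, ← Real.log_le_iff_le_exp n1,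
    ← Real.le_log_iff_exp_le n2, ← Real.log_le_iff_le_exp n2, ← Real.le_log_iff_exp_le n3,
    ← Real.log_le_iff_le_exp n3] using hq

/-- Laurent coefficients on the cyclic annulus decay exponentially in the hexagonal norm. -/
theorem exists_norm_laurentCoeff_le {K K' : ℝ} (hK' : 0 < K') (h : K' < K) {M : ℂ × ℂ → ℂ}
    (hM : DifferentiableOn ℂ M (cyclicAnnulus K)) : ∃ C : ℝ, 0 ≤ C ∧
    ∀ p, ‖laurentCoeff M p‖ ≤ C * Real.exp (-K') ^ hexNorm p := by
  obtain ⟨B, hB0, hB⟩ := exists_bound_of_hexSize_le h hM.continuousOn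
  refine ⟨B, hB0, fun p => ?_⟩
  -- The Cauchy estimate is best at the vertex of the hexagon of size K' whose pairing with p is
  -- maximal.
  obtain ⟨x, y, hx, hy, hxy, he⟩ := exists_hex_pairing_eq p hK'.le
  let q : ℂ × ℂ := (((Real.exp x : ℝ) : ℂ), ((Real.exp y : ℝ) : ℂ))
  have n1 : ‖q.1‖ = Real.exp x := by simp [q, -Complex.ofReal_exp]
  have n2 : ‖q.2‖ = Real.exp y := by simp [q, -Complex.ofReal_exp]
  have q1 : q.1 ≠ 0 := by rw [← norm_pos_iff, n1]; positivity
  have q2 : q.2 ≠ 0 := by rw [← norm_pos_iff, n2]; positivity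
  have hs : hexSize q ≤ K' := by
    rw [hexSize, n1, n2, Real.log_exp, Real.log_exp]
    exact max_le hx (max_le hy hxy)
  have hq : q ∈ cyclicAnnulus K := (mem_cyclicAnnulus_iff q1 q2).2 (hs.trans_lt h)
  refine (norm_laurentCoeff_le (hK'.trans h) hM hq (B := B) (fun q' h1 h2 => ?_) p).trans
    (le_of_eq ?_)
  · exact hB q' (by rw [← norm_pos_iff, h1, n1]; positivity)
      (by rw [← norm_pos_iff, h2, n2]; positivity) ((hexSize_congr h1 h2).le.trans hs)
  · rw [norm_laurentMonomial q1 q2, n1, n2, Real.log_exp, Real.log_exp, ← Real.exp_nat_mul]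
    congr 2
    push_cast [Prod.fst_neg, Prod.snd_neg]
    linarith

/-- Since |m| + |n| is at most twice the hexagonal norm, the product of two geometric series of
ratio √ρ dominates. -/
theorem summable_pow_hexNorm {ρ : ℝ} (h0 : 0 < ρ) (h1 : ρ < 1) :
    Summable fun p : ℤ × ℤ => ρ ^ hexNorm p := by
  set σ := Real.sqrt ρ with hσ
  have s0 : 0 < σ := Real.sqrt_pos.2 h0
  have s1 : σ < 1 := by rw [hσ, Real.sqrt_lt' one_pos]; simpa using h1
  have hg : Summable fun n : ℤ => σ ^ n.natAbs := by
    rw [summable_int_iff_summable_nat_and_neg]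
    simpa using summable_geometric_of_lt_one s0.le s1
  refine Summable.of_nonneg_of_le (fun p => by positivity) (fun p => ?_)
    (hg.mul_of_nonneg hg (fun _ => by positivity) fun _ => by positivity)
  have : ρ = σ ^ 2 := (Real.sq_sqrt h0.le).symm
  rw [this, ← pow_mul, ← pow_add]
  refine pow_le_pow_of_le_one s0.le s1.le ?_
  unfold hexNorm; omega

theorem summable_laurentCoeff {K : ℝ} {M : ℂ × ℂ → ℂ}
    (hM : DifferentiableOn ℂ M (cyclicAnnulus K)) {q : ℂ × ℂ} (hq : q ∈ cyclicAnnulus K) :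
    Summable fun p => laurentCoeff M p * laurentMonomial p q := by
  have h0 := cyclicAnnulus_ne_zero hq
  obtain ⟨K', hK1, hK2⟩ := exists_between (hexSize_lt hq)
  have hs := hexSize_nonneg q
  obtain ⟨C, hC0, hC⟩ := exists_norm_laurentCoeff_le (hs.trans_lt hK1) hK2 hM
  refine Summable.of_norm_bounded ((summable_pow_hexNorm (Real.exp_pos (hexSize q - K'))
    (by simpa using hK1)).mul_left C) fun p => ?_
  rw [norm_mul]
  refine (mul_le_mul (hC p) (norm_laurentMonomial_le h0.1 h0.2 p) (norm_nonneg _)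
    (by positivity)).trans (le_of_eq ?_)
  rw [← Real.exp_nat_mul, ← Real.exp_nat_mul, mul_assoc, ← Real.exp_add]
  congr 2
  ring

theorem hasSum_laurent {K : ℝ} (hK : 0 < K) {M : ℂ × ℂ → ℂ}
    (hM : DifferentiableOn ℂ M (cyclicAnnulus K)) {q : ℂ × ℂ} (hq : q ∈ cyclicAnnulus K) :
    HasSum (fun p => laurentCoeff M p * laurentMonomial p q) (M q) :=
  hasSum_laurentCoeff hK hM hq (summable_laurentCoeff hM hq)

theorem mem_cyclicAnnulus_of_norm_eq_one {K : ℝ} (hK : 0 < K) {q : ℂ × ℂ} (h1 : ‖q.1‖ = 1)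
    (h2 : ‖q.2‖ = 1) : q ∈ cyclicAnnulus K := by
  rw [mem_cyclicAnnulus_iff (by rw [← norm_pos_iff, h1]; exact one_pos)
    (by rw [← norm_pos_iff, h2]; exact one_pos), hexSize, h1, h2]
  simpa using hK

/-- Compact subsets of the cyclic annulus lie in a strictly smaller closed annulus. -/
theorem exists_hexSize_le_of_isCompact {K : ℝ} (hK : 0 < K) {S : Set (ℂ × ℂ)}
    (hS : S ⊆ cyclicAnnulus K) (hc : IsCompact S) :
    ∃ K' : ℝ, 0 < K' ∧ K' < K ∧ ∀ q ∈ S, hexSize q ≤ K' := by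
  rcases S.eq_empty_or_nonempty with rfl | hne
  · exact ⟨K / 2, by positivity, by linarith, by simp⟩
  have hcont : ContinuousOn hexSize S := by
    have h1 : ContinuousOn (fun q : ℂ × ℂ => Real.log ‖q.1‖) S :=
      (by fun_prop : ContinuousOn (fun q : ℂ × ℂ => ‖q.1‖) S).log fun q hq =>
        norm_ne_zero_iff.2 (cyclicAnnulus_ne_zero (hS hq)).1
    have h2 : ContinuousOn (fun q : ℂ × ℂ => Real.log ‖q.2‖) S :=
      (by fun_prop : ContinuousOn (fun q : ℂ × ℂ => ‖q.2‖) S).log fun q hq =>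
        norm_ne_zero_iff.2 (cyclicAnnulus_ne_zero (hS hq)).2
    exact h1.abs.sup (h2.abs.sup (h1.add h2).abs)
  obtain ⟨q, hq, hmax⟩ := hc.exists_isMaxOn hne hcont
  obtain ⟨K', h1, h2⟩ := exists_between (hexSize_lt (hS hq))
  exact ⟨K', (hexSize_nonneg q).trans_lt h1, h2, fun q' hq' => (hmax hq').trans h1.le⟩

/-! ### Symmetry and the Leibniz rule on Laurent coefficients. -/

theorem laurentCoeff_unique {c d : ℤ × ℤ → ℂ} (hc : Summable c) (hd : Summable d)
    (f : ℂ × ℂ → ℂ)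
    (h1 : ∀ q : ℂ × ℂ, ‖q.1‖ = 1 → ‖q.2‖ = 1 → HasSum (fun p => c p * laurentMonomial p q) (f q))
    (h2 : ∀ q : ℂ × ℂ, ‖q.1‖ = 1 → ‖q.2‖ = 1 → HasSum (fun p => d p * laurentMonomial p q) (f q))
    (p : ℤ × ℤ) : c p = d p := by
  refine sub_eq_zero.1 (laurent_coeff_eq_zero (hc.sub hd) (fun t => ?_) p)
  have e1 : ‖(torusPoint 1 1 t).1‖ = 1 := by
    simp [torusPoint, norm_unitAddCircle_toCircle (t 0)]
  have e2 : ‖(torusPoint 1 1 t).2‖ = 1 := by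
    simp [torusPoint, norm_unitAddCircle_toCircle (t 1)]
  have := (h1 _ e1 e2).sub (h2 _ e1 e2)
  simpa only [sub_self, ← sub_mul] using this

theorem summable_laurentCoeff_self {K : ℝ} (hK : 0 < K) {M : ℂ × ℂ → ℂ}
    (hM : DifferentiableOn ℂ M (cyclicAnnulus K)) : Summable (laurentCoeff M) := by
  simpa [laurentMonomial] using summable_laurentCoeff hM
    (mem_cyclicAnnulus_of_norm_eq_one hK (q := (1, 1)) (by simp) (by simp))

theorem laurentCoeff_swap {K : ℝ} (hK : 0 < K) {M : ℂ × ℂ → ℂ}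
    (hM : DifferentiableOn ℂ M (cyclicAnnulus K))
    (hsymm : ∀ w z : ℂ, (w, z) ∈ cyclicAnnulus K → M (w, z) = M (z, w)) (p : ℤ × ℤ) :
    laurentCoeff M p.swap = laurentCoeff M p := by
  refine laurentCoeff_unique (c := fun p => laurentCoeff M p.swap) (f := M) ?_ (summable_laurentCoeff_self hK hM) ?_ ?_ p
  · exact (Equiv.prodComm ℤ ℤ).summable_iff.2 (summable_laurentCoeff_self hK hM)
  · rintro ⟨w, z⟩ h1 h2
    rw [hsymm w z (mem_cyclicAnnulus_of_norm_eq_one hK h1 h2)]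
    have := (Equiv.prodComm ℤ ℤ).hasSum_iff.2
      (hasSum_laurent hK hM (mem_cyclicAnnulus_of_norm_eq_one hK (q := (z, w)) h2 h1))
    convert this using 2 with p
    simp [laurentMonomial, mul_comm]
  · exact fun q h1 h2 => hasSum_laurent hK hM (mem_cyclicAnnulus_of_norm_eq_one hK h1 h2)

/-- Here q' is a cyclic image of q and v a monomial factor from the difference operator; e relabels
exponents so that the product becomes a Laurent series in q again. -/
theorem hasSum_laurent_reindex {K : ℝ} (hK : 0 < K) {M : ℂ × ℂ → ℂ}
    (hM : DifferentiableOn ℂ M (cyclicAnnulus K)) (e : ℤ × ℤ ≃ ℤ × ℤ) {q q' : ℂ × ℂ} {v : ℂ}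
    (hq : q' ∈ cyclicAnnulus K) (h : ∀ p, laurentMonomial (e p) q' * v = laurentMonomial p q) :
    HasSum (fun p => laurentCoeff M (e p) * laurentMonomial p q) (M q' * v) := by
  have := (e.hasSum_iff.2 (hasSum_laurent hK hM hq)).mul_right v
  simpa only [Function.comp_def, mul_assoc, h] using this

/-- The cyclic Leibniz rule with the naive symmetric difference, on Laurent coefficients. -/
theorem laurentCoeff_cyclicLeibniz {K : ℝ} (hK : 0 < K) {M : ℂ × ℂ → ℂ}
    (hM : DifferentiableOn ℂ M (cyclicAnnulus K)) (hL : CyclicLeibnizRule naiveDelta K M)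
    (m n : ℤ) :
    laurentCoeff M (m + 1, n + 1) - laurentCoeff M (m - 1, n - 1)
      + (laurentCoeff M (n - m + 1, 1 - m) - laurentCoeff M (n - m - 1, -m - 1))
      + (laurentCoeff M (1 - n, m - n + 1) - laurentCoeff M (-n - 1, m - n - 1)) = 0 := by
  -- Doubling the rule gives six terms: M at each of the three cyclic points, times a monomial or
  -- its inverse. Each gets its own relabelling of exponents, and the coefficients of the total
  -- vanish by uniqueness on the unit torus.
  let e1 : ℤ × ℤ ≃ ℤ × ℤ := ⟨fun p => (p.1 + 1, p.2 + 1), fun p => (p.1 - 1, p.2 - 1),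
    fun p => by ext <;> dsimp only <;> ring,
    fun p => by ext <;> dsimp only <;> ring⟩
  let e2 : ℤ × ℤ ≃ ℤ × ℤ := ⟨fun p => (p.1 - 1, p.2 - 1), fun p => (p.1 + 1, p.2 + 1),
    fun p => by ext <;> dsimp only <;> ring,
    fun p => by ext <;> dsimp only <;> ring⟩
  let e3 : ℤ × ℤ ≃ ℤ × ℤ := ⟨fun p => (p.2 - p.1 + 1, 1 - p.1), fun p => (1 - p.2, p.1 - p.2),
    fun p => by ext <;> dsimp only <;> ring,
    fun p => by ext <;> dsimp only <;> ring⟩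
  let e4 : ℤ × ℤ ≃ ℤ × ℤ := ⟨fun p => (p.2 - p.1 - 1, -p.1 - 1), fun p => (-p.2 - 1, p.1 - p.2),
    fun p => by ext <;> dsimp only <;> ring,
    fun p => by ext <;> dsimp only <;> ring⟩
  let e5 : ℤ × ℤ ≃ ℤ × ℤ := ⟨fun p => (1 - p.2, p.1 - p.2 + 1), fun p => (p.2 - p.1, 1 - p.1),
    fun p => by ext <;> dsimp only <;> ring,
    fun p => by ext <;> dsimp only <;> ring⟩
  let e6 : ℤ × ℤ ≃ ℤ × ℤ := ⟨fun p => (-p.2 - 1, p.1 - p.2 - 1), fun p => (p.2 - p.1, -p.1 - 1),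
    fun p => by ext <;> dsimp only <;> ring,
    fun p => by ext <;> dsimp only <;> ring⟩
  have hs : ∀ e : ℤ × ℤ ≃ ℤ × ℤ, Summable fun p => laurentCoeff M (e p) := fun e =>
    e.summable_iff.2 (summable_laurentCoeff_self hK hM)
  refine laurentCoeff_unique (f := fun _ => 0)
    (c := fun p => laurentCoeff M (e1 p) - laurentCoeff M (e2 p)
      + (laurentCoeff M (e3 p) - laurentCoeff M (e4 p))
      + (laurentCoeff M (e5 p) - laurentCoeff M (e6 p))) (d := fun _ => 0)
    ((((hs e1).sub (hs e2)).add ((hs e3).sub (hs e4))).add ((hs e5).sub (hs e6)))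
    summable_zero ?_ (fun q _ _ => by simp) (m, n)
  rintro ⟨w, z⟩ h1 h2
  simp only at h1 h2
  have hw : w ≠ 0 := by rw [← norm_pos_iff, h1]; exact one_pos
  have hz : z ≠ 0 := by rw [← norm_pos_iff, h2]; exact one_pos
  have hu : ‖1 / (w * z)‖ = 1 := by simp [h1, h2]
  have m1 := mem_cyclicAnnulus_of_norm_eq_one hK (q := (w, z)) h1 h2
  have m2 := mem_cyclicAnnulus_of_norm_eq_one hK (q := (z, 1 / (w * z))) h2 hu
  have m3 := mem_cyclicAnnulus_of_norm_eq_one hK (q := (1 / (w * z), w)) hu h1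
  have s1 := hasSum_laurent_reindex hK hM e1 (q := (w, z)) (v := 1 / (w * z)) m1 fun p => by
    simp only [laurentMonomial, e1, Equiv.coe_fn_mk, zpow_add₀ hw, zpow_add₀ hz, zpow_one]
    field_simp
  have s2 := hasSum_laurent_reindex hK hM e2 (q := (w, z)) (v := w * z) m1 fun p => by
    simp only [laurentMonomial, e2, Equiv.coe_fn_mk, zpow_sub₀ hw, zpow_sub₀ hz, zpow_one]
    field_simp
  have s3 := hasSum_laurent_reindex hK hM e3 (q := (w, z)) (v := w) m2 fun p => by
    simp only [laurentMonomial, e3, Equiv.coe_fn_mk, one_div, inv_zpow', neg_sub, mul_zpow,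
      zpow_sub₀ hw, zpow_sub₀ hz, zpow_add₀ hz, zpow_one]
    field_simp
  have s4 := hasSum_laurent_reindex hK hM e4 (q := (w, z)) (v := 1 / w) m2 fun p => by
    simp only [laurentMonomial, e4, Equiv.coe_fn_mk, one_div, inv_zpow', neg_sub, sub_neg_eq_add,
      mul_zpow, zpow_sub₀ hz, zpow_add₀ hz, zpow_add₀ hw, zpow_one]
    field_simp
  have s5 := hasSum_laurent_reindex hK hM e5 (q := (w, z)) (v := z) m3 fun p => by
    simp only [laurentMonomial, e5, Equiv.coe_fn_mk, one_div, inv_zpow', neg_sub, mul_zpow,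
      zpow_sub₀ hw, zpow_sub₀ hz, zpow_add₀ hw, zpow_one]
    field_simp
  have s6 := hasSum_laurent_reindex hK hM e6 (q := (w, z)) (v := 1 / z) m3 fun p => by
    simp only [laurentMonomial, e6, Equiv.coe_fn_mk, one_div, inv_zpow', neg_sub, sub_neg_eq_add,
      mul_zpow, zpow_sub₀ hw, zpow_add₀ hz, zpow_add₀ hw, zpow_one]
    field_simp
  have hsum := ((s1.sub s2).add (s3.sub s4)).add (s5.sub s6)
  have hzero : M (w, z) * (1 / (w * z)) - M (w, z) * (w * z)
      + (M (z, 1 / (w * z)) * w - M (z, 1 / (w * z)) * (1 / w))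
      + (M (1 / (w * z), w) * z - M (1 / (w * z), w) * (1 / z)) = 0 := by
    have := hL w z m1
    simp only [naiveDelta, one_div_one_div] at this
    linear_combination 2 * this
  rw [hzero] at hsum
  simpa only [← sub_mul, ← add_mul] using hsum

/-! ### Alternating tails and decaying sequences. -/

/-- The alternating tail `f n - g (n + 1) + f (n + 2) - ⋯`. -/
noncomputable def alternatingTail (f g : ℕ → ℂ) (n : ℕ) : ℂ :=
  ∑' k, if Even k then f (n + k) else -g (n + k)

theorem norm_alternating_term_le {f g : ℕ → ℂ} {C ρ : ℝ} (hf : ∀ n, ‖f n‖ ≤ C * ρ ^ n)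
    (hg : ∀ n, ‖g n‖ ≤ C * ρ ^ n) (n k : ℕ) :
    ‖if Even k then f (n + k) else -g (n + k)‖ ≤ C * ρ ^ n * ρ ^ k := by
  rw [mul_assoc, ← pow_add]
  split_ifs
  · exact hf _
  · rw [norm_neg]; exact hg _

theorem summable_alternating_term {f g : ℕ → ℂ} {C ρ : ℝ} (h0 : 0 ≤ ρ) (h1 : ρ < 1)
    (hf : ∀ n, ‖f n‖ ≤ C * ρ ^ n) (hg : ∀ n, ‖g n‖ ≤ C * ρ ^ n) (n : ℕ) :
    Summable fun k => if Even k then f (n + k) else -g (n + k) :=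
  Summable.of_norm_bounded ((summable_geometric_of_lt_one h0 h1).mul_left (C * ρ ^ n))
    (norm_alternating_term_le hf hg n)

theorem norm_alternatingTail_le {f g : ℕ → ℂ} {C ρ : ℝ} (h0 : 0 ≤ ρ) (h1 : ρ < 1)
    (hf : ∀ n, ‖f n‖ ≤ C * ρ ^ n) (hg : ∀ n, ‖g n‖ ≤ C * ρ ^ n) (n : ℕ) :
    ‖alternatingTail f g n‖ ≤ C / (1 - ρ) * ρ ^ n := by
  have := tsum_of_norm_bounded ((hasSum_geometric_of_lt_one h0 h1).mul_left (C * ρ ^ n))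
    (norm_alternating_term_le hf hg n)
  refine this.trans (le_of_eq ?_)
  ring

/-- Without its first term, the tail is minus the next tail with f and g exchanged. -/
theorem add_alternatingTail {f g : ℕ → ℂ} {C ρ : ℝ} (h0 : 0 ≤ ρ) (h1 : ρ < 1)
    (hf : ∀ n, ‖f n‖ ≤ C * ρ ^ n) (hg : ∀ n, ‖g n‖ ≤ C * ρ ^ n) (n : ℕ) :
    alternatingTail f g n + alternatingTail g f (n + 1) = f n := by
  rw [alternatingTail, (summable_alternating_term h0 h1 hf hg n).tsum_eq_zero_add, alternatingTail]
  have : ∀ k, (if Even (k + 1) then f (n + (k + 1)) else -g (n + (k + 1))) =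
      -(if Even k then g (n + 1 + k) else -f (n + 1 + k)) := by
    intro k
    rw [show n + 1 + k = n + (k + 1) by ring]
    by_cases hk : Even k <;> simp [hk, Nat.even_add_one]
  simp only [this, tsum_neg]
  simp

/-- The principle that turns the Leibniz recurrence, which only controls differences, into exact
identities. -/
theorem eq_zero_of_periodic_of_decay {e : ℕ → ℂ} {d : ℕ} {D ρ : ℝ} (hd : 0 < d) (h0 : 0 ≤ ρ)
    (h1 : ρ < 1) (hper : ∀ n, e (n + d) = e n) (hb : ∀ n, ‖e n‖ ≤ D * ρ ^ n) (n : ℕ) :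
    e n = 0 := by
  have hk : ∀ k, e (n + k * d) = e n := by
    intro k
    induction k with
    | zero => simp
    | succ k ih => rw [show n + (k + 1) * d = n + k * d + d by ring, hper, ih]
  have hlim : Tendsto (fun k => D * ρ ^ (n + k * d)) atTop (nhds 0) := by
    have h2 : Tendsto (fun k => n + k * d) atTop atTop :=
      tendsto_atTop_mono
        (fun k => (Nat.le_mul_of_pos_right k hd).trans (Nat.le_add_left _ _)) tendsto_id
    simpa using ((tendsto_pow_atTop_nhds_zero_of_lt_one h0 h1).comp h2).const_mul D
  have := ge_of_tendsto' hlim fun k => (hk k ▸ hb (n + k * d) : ‖e n‖ ≤ _)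
  exact norm_le_zero_iff.1 this

/-! ### The coefficients of the minimal solutions. -/

/-- The coefficient of the minimal solution of the first type with leading term `w ^ n * z ^ b`. -/
noncomputable def coeffOne (a : ℤ × ℤ → ℂ) (n : ℕ) (b : ℤ) : ℂ :=
  alternatingTail (fun n => a (n, b)) (fun n => a (n - b, -b)) n

/-- The coefficient of the minimal solution of the second type with leading term
`w ^ (n - b) * z ^ (-b)`. -/
noncomputable def coeffTwo (a : ℤ × ℤ → ℂ) (n : ℕ) (b : ℤ) : ℂ :=
  alternatingTail (fun n => a (n - b, -b)) (fun n => a (n, b)) n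

section Hexagonal

variable {a : ℤ × ℤ → ℂ} {C ρ : ℝ}

theorem norm_le_of_le_hexNorm (hC : 0 ≤ C) (h0 : 0 ≤ ρ) (h1 : ρ < 1)
    (ha : ∀ p, ‖a p‖ ≤ C * ρ ^ hexNorm p) {n : ℕ} {p : ℤ × ℤ} (h : n ≤ hexNorm p) :
    ‖a p‖ ≤ C * ρ ^ n :=
  (ha p).trans (mul_le_mul_of_nonneg_left (pow_le_pow_of_le_one h0 h1.le h) hC)

/-- The bound holds for every integer b, not only on the side of the hexagon; the periodicity
arguments move along whole lines and need this. -/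
theorem norm_right_le (hC : 0 ≤ C) (h0 : 0 ≤ ρ) (h1 : ρ < 1)
    (ha : ∀ p, ‖a p‖ ≤ C * ρ ^ hexNorm p) (b : ℤ) (n : ℕ) : ‖a (n, b)‖ ≤ C * ρ ^ n :=
  norm_le_of_le_hexNorm hC h0 h1 ha (by unfold hexNorm; omega)

theorem norm_lower_le (hC : 0 ≤ C) (h0 : 0 ≤ ρ) (h1 : ρ < 1)
    (ha : ∀ p, ‖a p‖ ≤ C * ρ ^ hexNorm p) (b : ℤ) (n : ℕ) : ‖a (n - b, -b)‖ ≤ C * ρ ^ n :=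
  norm_le_of_le_hexNorm hC h0 h1 ha (by unfold hexNorm; omega)

theorem norm_coeffOne_le (hC : 0 ≤ C) (h0 : 0 ≤ ρ) (h1 : ρ < 1)
    (ha : ∀ p, ‖a p‖ ≤ C * ρ ^ hexNorm p) (n : ℕ) (b : ℤ) :
    ‖coeffOne a n b‖ ≤ C / (1 - ρ) * ρ ^ n :=
  norm_alternatingTail_le h0 h1 (norm_right_le hC h0 h1 ha b) (norm_lower_le hC h0 h1 ha b) n

theorem norm_coeffTwo_le (hC : 0 ≤ C) (h0 : 0 ≤ ρ) (h1 : ρ < 1)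
    (ha : ∀ p, ‖a p‖ ≤ C * ρ ^ hexNorm p) (n : ℕ) (b : ℤ) :
    ‖coeffTwo a n b‖ ≤ C / (1 - ρ) * ρ ^ n :=
  norm_alternatingTail_le h0 h1 (norm_lower_le hC h0 h1 ha b) (norm_right_le hC h0 h1 ha b) n

theorem coeff_right (hC : 0 ≤ C) (h0 : 0 ≤ ρ) (h1 : ρ < 1)
    (ha : ∀ p, ‖a p‖ ≤ C * ρ ^ hexNorm p) (n : ℕ) (b : ℤ) :
    a (n, b) = coeffOne a n b + coeffTwo a (n + 1) b :=
  (add_alternatingTail h0 h1 (norm_right_le hC h0 h1 ha b) (norm_lower_le hC h0 h1 ha b) n).symm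

theorem coeff_lower (hC : 0 ≤ C) (h0 : 0 ≤ ρ) (h1 : ρ < 1)
    (ha : ∀ p, ‖a p‖ ≤ C * ρ ^ hexNorm p) (n : ℕ) (b : ℤ) :
    a (n - b, -b) = coeffTwo a n b + coeffOne a (n + 1) b :=
  (add_alternatingTail h0 h1 (norm_lower_le hC h0 h1 ha b) (norm_right_le hC h0 h1 ha b) n).symm

/-- Neither tail was defined by these coefficients of a, so here the Leibniz rule enters. The
recurrence at (n + 1, b), with the symmetry, says that the difference of the two sides is unchanged
under n ↦ n + 2; it also decays, hence is 0. -/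
theorem coeff_left (hC : 0 ≤ C) (h0 : 0 ≤ ρ) (h1 : ρ < 1)
    (ha : ∀ p, ‖a p‖ ≤ C * ρ ^ hexNorm p) (hsw : ∀ p, a p.swap = a p)
    (hrel : ∀ m n, a (m + 1, n + 1) - a (m - 1, n - 1) + (a (n - m + 1, 1 - m)
      - a (n - m - 1, -m - 1)) + (a (1 - n, m - n + 1) - a (-n - 1, m - n - 1)) = 0)
    (n : ℕ) (b : ℤ) :
    a (b - n, -n) = coeffOne a n (b - 1) + coeffTwo a (n + 1) (b + 1) := by
  rw [← sub_eq_zero]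
  set D := C / (1 - ρ)
  have hD : 0 ≤ D := div_nonneg hC (by linarith)
  refine eq_zero_of_periodic_of_decay (d := 2) (D := C + (D + D))
    (e := fun n : ℕ => a (b - n, -n) - (coeffOne a n (b - 1) + coeffTwo a (n + 1) (b + 1)))
    two_pos h0 h1 (fun n => ?_) (fun n => ?_) n
  · have h := hrel (n + 1 : ℕ) b
    have r1 := coeff_right hC h0 h1 ha (n + 2) (b + 1)
    have r2 := coeff_right hC h0 h1 ha n (b - 1)
    have t1 := coeff_lower hC h0 h1 ha (n + 1) (b - 1)
    have t2 := coeff_lower hC h0 h1 ha (n + 1) (b + 1)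
    have s1 := hsw (1 - b, ((n + 1 : ℕ) : ℤ) - b + 1)
    have s2 := hsw (-b - 1, ((n + 1 : ℕ) : ℤ) - b - 1)
    simp only [Prod.swap_prod_mk] at s1 s2
    -- The symmetry moves the last two terms onto points of the form (k - c, -c), where
    -- `coeff_lower` applies.
    rw [← s1, ← s2] at h
    push_cast at *
    ring_nf at *
    linear_combination r1 - r2 + t1 - t2 - h
  · have b1 := norm_le_of_le_hexNorm hC h0 h1 ha (n := n) (p := (b - n, -n))
      (by unfold hexNorm; omega)
    have b2 := norm_coeffOne_le hC h0 h1 ha n (b - 1)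
    have b3 := norm_coeffTwo_le hC h0 h1 ha (n + 1) (b + 1)
    have b4 : D * ρ ^ (n + 1) ≤ D * ρ ^ n :=
      mul_le_mul_of_nonneg_left (pow_le_pow_of_le_one h0 h1.le n.le_succ) hD
    calc _ ≤ ‖a (b - n, -n)‖ + (‖coeffOne a n (b - 1)‖ + ‖coeffTwo a (n + 1) (b + 1)‖) :=
          (norm_sub_le _ _).trans (add_le_add_right (norm_add_le _ _) _)
      _ ≤ C * ρ ^ n + (D * ρ ^ n + D * ρ ^ n) := by gcongr; exact b3.trans b4
      _ = _ := by ring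

theorem coeffTwo_zero (a : ℤ × ℤ → ℂ) (n : ℕ) : coeffTwo a n 0 = coeffOne a n 0 := by
  simp [coeffTwo, coeffOne]

theorem coeffOne_neg_one (a : ℤ × ℤ → ℂ) (n : ℕ) :
    coeffOne a n (-1) = coeffTwo a (n + 1) 1 := by
  rw [coeffOne, coeffTwo, alternatingTail, alternatingTail]
  refine tsum_congr fun k => ?_
  push_cast
  split_ifs
  · congr 2; ring
  · congr 3; ring

/-- The point (b - n, -n) is covered by both `coeff_left` and `coeff_lower`. Equating the two
expansions carries the defect at (n, b) to the defect at (b + 1, n + 1); two such steps shift both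
indices by 2, and decay along the diagonal forces 0. -/
theorem coeffOne_eq_coeffTwo (hC : 0 ≤ C) (h0 : 0 ≤ ρ) (h1 : ρ < 1)
    (ha : ∀ p, ‖a p‖ ≤ C * ρ ^ hexNorm p) (hsw : ∀ p, a p.swap = a p)
    (hrel : ∀ m n, a (m + 1, n + 1) - a (m - 1, n - 1) + (a (n - m + 1, 1 - m)
      - a (n - m - 1, -m - 1)) + (a (1 - n, m - n + 1) - a (-n - 1, m - n - 1)) = 0)
    (n b : ℕ) : coeffOne a n (b - 1) = coeffTwo a b n := by
  set D := C / (1 - ρ)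
  have key : ∀ n b : ℕ, coeffOne a n (b - 1) - coeffTwo a b n =
      coeffOne a (b + 1) ((n + 1 : ℕ) - 1) - coeffTwo a (n + 1) (b + 1 : ℕ) := fun n b => by
    have e1 := coeff_left hC h0 h1 ha hsw hrel n b
    have e2 := coeff_lower hC h0 h1 ha b n
    push_cast
    rw [add_sub_cancel_right]
    linear_combination e2 - e1
  have hD : 0 ≤ D := div_nonneg hC (by linarith)
  have := eq_zero_of_periodic_of_decay (d := 2) (D := D + D)
    (e := fun k : ℕ => coeffOne a (n + k) ((b + k : ℕ) - 1) - coeffTwo a (b + k) (n + k : ℕ))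
    two_pos h0 h1 (fun k => ?_) (fun k => ?_) 0
  · simpa [sub_eq_zero] using this
  · exact ((key (n + k) (b + k)).trans (key (b + k + 1) (n + k + 1))).symm
  · have b1 := norm_coeffOne_le hC h0 h1 ha (n + k) ((b + k : ℕ) - 1)
    have b2 := norm_coeffTwo_le hC h0 h1 ha (b + k) (n + k : ℕ)
    have b3 : D * ρ ^ (n + k) ≤ D * ρ ^ k :=
      mul_le_mul_of_nonneg_left (pow_le_pow_of_le_one h0 h1.le (by omega)) hD
    have b4 : D * ρ ^ (b + k) ≤ D * ρ ^ k :=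
      mul_le_mul_of_nonneg_left (pow_le_pow_of_le_one h0 h1.le (by omega)) hD
    refine (norm_sub_le _ _).trans ?_
    rw [add_mul]
    exact add_le_add (b1.trans b3) (b2.trans b4)

end Hexagonal

/-! ### Hexagon sums, blocks and telescoping. -/

theorem sum_range_shift (f : ℕ → ℂ) (n : ℕ) :
    ∑ b ∈ Finset.range n, f (b + 1) = ∑ b ∈ Finset.range n, f b + f n - f 0 := by
  rw [← Finset.sum_range_succ, Finset.sum_range_succ', add_sub_cancel_right]

theorem sum_Ico_one (f : ℕ → ℂ) {n : ℕ} (hn : 1 ≤ n) :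
    ∑ b ∈ Finset.Ico 1 n, f b = ∑ b ∈ Finset.range n, f b - f 0 := by
  rw [Finset.sum_Ico_eq_sub _ hn, Finset.sum_range_one]

/-- The terms of degree `n` in the `n`-th block of the series with coefficients `P`, `Q`. -/
noncomputable def outerBlock (P Q : ℕ → ℤ → ℂ) (m : ℤ × ℤ → ℂ) (n : ℕ) : ℂ :=
  ∑ b ∈ Finset.range n, P n b * (m (n, b) + m (b, n) + m (b + 1 - n, -n) + m (-n, b + 1 - n)) +
    ∑ b ∈ Finset.Ico 1 n, Q n b * (m (n - b, -b) + m (-b, n - b))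

/-- The terms of degree `n - 1` in the `n`-th block of the series with coefficients `P`, `Q`. -/
noncomputable def innerBlock (P Q : ℕ → ℤ → ℂ) (m : ℤ × ℤ → ℂ) (n : ℕ) : ℂ :=
  ∑ b ∈ Finset.range n, P n b * (m (n - 1 - b, -b) + m (-b, n - 1 - b)) +
    ∑ b ∈ Finset.Ico 1 n,
      Q n b * (m (n - 1, b) + m (b, n - 1) + m (b - n, 1 - n) + m (1 - n, b - n))

/-- The sum of `F` over the six sides of the hexagon of radius `n`. -/
noncomputable def hexagonSum (F : ℤ × ℤ → ℂ) (n : ℕ) : ℂ :=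
  ∑ b ∈ Finset.range n, F (n, b) + ∑ b ∈ Finset.range n, F (b + 1, n) +
    ∑ b ∈ Finset.range n, F (-b, n - b) + ∑ b ∈ Finset.range n, F (-n, b + 1 - n) +
    ∑ b ∈ Finset.range n, F (b - n, -n) + ∑ b ∈ Finset.range n, F (n - (b + 1), -(b + 1))

/-- On each side every a(p) splits into a coefficient of level n, which belongs to an outer term,
and one of level n + 1, which belongs to an inner term. The sides and the blocks use different index
ranges, so terms at the ends are left over; `c0`, `c1`, `c2` cancel them. -/
theorem hexagonSum_eq_blocks {a : ℤ × ℤ → ℂ} {P Q : ℕ → ℤ → ℂ} (m : ℤ × ℤ → ℂ)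
    (hsw : ∀ p, a p.swap = a p)
    (hr : ∀ (n : ℕ) (b : ℤ), a (n, b) = P n b + Q (n + 1) b)
    (ht : ∀ (n : ℕ) (b : ℤ), a (n - b, -b) = Q n b + P (n + 1) b)
    (hl : ∀ (n : ℕ) (b : ℤ), a (b - n, -n) = P n (b - 1) + Q (n + 1) (b + 1))
    (c0 : ∀ n, Q n 0 = P n 0) (c1 : ∀ n, P n (-1) = Q (n + 1) 1)
    (c2 : ∀ n b : ℕ, P n (b - 1) = Q b n) {n : ℕ} (hn : 1 ≤ n) :
    hexagonSum (fun p => a p * m p) n = outerBlock P Q m n + innerBlock P Q m (n + 1) := by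
  have hsw' : ∀ x y, a (x, y) = a (y, x) := fun x y => hsw (y, x)
  have T1 : ∑ b ∈ Finset.range n, a (n, b) * m (n, b) =
      ∑ b ∈ Finset.range n, P n b * m (n, b) + ∑ b ∈ Finset.range n, Q (n + 1) b * m (n, b) := by
    simp only [hr, add_mul, Finset.sum_add_distrib]
  have T2 : ∑ b ∈ Finset.range n, a (b + 1, n) * m (b + 1, n) =
      (∑ b ∈ Finset.range n, P n b * m (b, n) + P n n * m (n, n) - P n 0 * m (0, n)) +
      (∑ b ∈ Finset.range n, Q (n + 1) b * m (b, n) + Q (n + 1) n * m (n, n)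
        - Q (n + 1) 0 * m (0, n)) := by
    have e1 := sum_range_shift (fun b => P n b * m (b, n)) n
    have e2 := sum_range_shift (fun b => Q (n + 1) b * m (b, n)) n
    push_cast at e1 e2
    rw [← e1, ← e2, ← Finset.sum_add_distrib]
    refine Finset.sum_congr rfl fun b _ => ?_
    rw [hsw', hr, add_mul]
  have T3 : ∑ b ∈ Finset.range n, a (-b, n - b) * m (-b, n - b) =
      ∑ b ∈ Finset.range n, Q n b * m (-b, n - b)
        + ∑ b ∈ Finset.range n, P (n + 1) b * m (-b, n - b) := by
    rw [← Finset.sum_add_distrib]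
    refine Finset.sum_congr rfl fun b _ => ?_
    rw [hsw', ht, add_mul]
  have T4 : ∑ b ∈ Finset.range n, a (-n, b + 1 - n) * m (-n, b + 1 - n) =
      ∑ b ∈ Finset.range n, P n b * m (-n, b + 1 - n) +
      (∑ b ∈ Finset.range n, Q (n + 1) b * m (-n, b - 1 - n)
        + Q (n + 1) n * m (-n, -1) - Q (n + 1) 0 * m (-n, -1 - n)
        + Q (n + 1) (n + 1) * m (-n, 0) - Q (n + 1) 1 * m (-n, -n)) := by
    -- On this side Q carries the index b + 2, so the shift is applied twice.
    have e1 := sum_range_shift (fun b => Q (n + 1) b * m (-n, b - 1 - n)) n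
    have e2 := sum_range_shift (fun b => Q (n + 1) (b + 1 : ℕ) * m (-n, (b + 1 : ℕ) - 1 - n)) n
    push_cast at e1 e2
    have i1 : (n : ℤ) - 1 - n = -1 := by ring
    have i2 : (n : ℤ) + 1 - 1 - n = 0 := by ring
    rw [i1] at e1
    rw [i2, zero_sub] at e2
    have e3 : ∑ b ∈ Finset.range n, a (-n, b + 1 - n) * m (-n, b + 1 - n) =
        ∑ b ∈ Finset.range n, P n b * m (-n, b + 1 - n) +
        ∑ b ∈ Finset.range n, Q (n + 1) (b + 1 + 1) * m (-n, (b + 1 + 1) - 1 - n) := by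
      rw [← Finset.sum_add_distrib]
      refine Finset.sum_congr rfl fun b _ => ?_
      rw [hsw', hl, add_sub_cancel_right, add_sub_cancel_right, add_mul]
    rw [e3, e2, e1]
  have T5 : ∑ b ∈ Finset.range n, a (b - n, -n) * m (b - n, -n) =
      (∑ b ∈ Finset.range n, P n b * m (b + 1 - n, -n)
        - P n (n - 1) * m (0, -n) + P n (-1) * m (-n, -n)) +
      (∑ b ∈ Finset.range n, Q (n + 1) b * m (b - 1 - n, -n) + Q (n + 1) n * m (-1, -n)
        - Q (n + 1) 0 * m (-1 - n, -n)) := by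
    have e1 := sum_range_shift (fun b => P n (b - 1) * m (b - n, -n)) n
    have e2 := sum_range_shift (fun b => Q (n + 1) b * m (b - 1 - n, -n)) n
    push_cast at e1 e2
    simp only [add_sub_cancel_right, sub_self, zero_sub] at e1 e2
    have i1 : (n : ℤ) - 1 - n = -1 := by ring
    rw [i1] at e2
    have e3 : ∑ b ∈ Finset.range n, a (b - n, -n) * m (b - n, -n) =
        ∑ b ∈ Finset.range n, P n (b - 1) * m (b - n, -n) +
        ∑ b ∈ Finset.range n, Q (n + 1) (b + 1) * m (b - n, -n) := by
      rw [← Finset.sum_add_distrib]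
      refine Finset.sum_congr rfl fun b _ => ?_
      rw [hl, add_mul]
    rw [e3, e2, e1]
    ring
  have T6 : ∑ b ∈ Finset.range n, a (n - (b + 1), -(b + 1)) * m (n - (b + 1), -(b + 1)) =
      (∑ b ∈ Finset.range n, Q n b * m (n - b, -b) + Q n n * m (0, -n) - Q n 0 * m (n, 0)) +
      (∑ b ∈ Finset.range n, P (n + 1) b * m (n - b, -b) + P (n + 1) n * m (0, -n)
        - P (n + 1) 0 * m (n, 0)) := by
    have e1 := sum_range_shift (fun b => Q n b * m (n - b, -b)) n
    have e2 := sum_range_shift (fun b => P (n + 1) b * m (n - b, -b)) n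
    push_cast at e1 e2
    simp only [sub_self, sub_zero, neg_zero] at e1 e2
    rw [← e1, ← e2, ← Finset.sum_add_distrib]
    refine Finset.sum_congr rfl fun b _ => ?_
    rw [ht, add_mul]
  have O : outerBlock P Q m n =
      ∑ b ∈ Finset.range n, P n b * m (n, b) + ∑ b ∈ Finset.range n, P n b * m (b, n)
      + ∑ b ∈ Finset.range n, P n b * m (b + 1 - n, -n)
      + ∑ b ∈ Finset.range n, P n b * m (-n, b + 1 - n)
      + (∑ b ∈ Finset.range n, Q n b * m (n - b, -b) - Q n 0 * m (n, 0))
      + (∑ b ∈ Finset.range n, Q n b * m (-b, n - b) - Q n 0 * m (0, n)) := by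
    rw [outerBlock, sum_Ico_one _ hn]
    simp only [mul_add, Finset.sum_add_distrib, Nat.cast_zero, sub_zero, neg_zero]
    ring
  have I : innerBlock P Q m (n + 1) =
      (∑ b ∈ Finset.range n, P (n + 1) b * m (n - b, -b) + P (n + 1) n * m (0, -n))
      + (∑ b ∈ Finset.range n, P (n + 1) b * m (-b, n - b) + P (n + 1) n * m (-n, 0))
      + (∑ b ∈ Finset.range n, Q (n + 1) b * m (n, b) + Q (n + 1) n * m (n, n)
        - Q (n + 1) 0 * m (n, 0))
      + (∑ b ∈ Finset.range n, Q (n + 1) b * m (b, n) + Q (n + 1) n * m (n, n)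
        - Q (n + 1) 0 * m (0, n))
      + (∑ b ∈ Finset.range n, Q (n + 1) b * m (b - 1 - n, -n) + Q (n + 1) n * m (-1, -n)
        - Q (n + 1) 0 * m (-1 - n, -n))
      + (∑ b ∈ Finset.range n, Q (n + 1) b * m (-n, b - 1 - n) + Q (n + 1) n * m (-n, -1)
        - Q (n + 1) 0 * m (-n, -1 - n)) := by
    have i1 : ∀ b : ℤ, b - ((n : ℤ) + 1) = b - 1 - n := fun b => by ring
    have i2 : (n : ℤ) - 1 - n = -1 := by ring
    have i3 : 1 - ((n : ℤ) + 1) = -n := by ring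
    rw [innerBlock, sum_Ico_one _ (Nat.le_add_left 1 n)]
    push_cast
    simp only [mul_add, Finset.sum_add_distrib, Finset.sum_range_succ, add_sub_cancel_right,
      sub_self, i3, i1, i2, zero_sub]
    ring
  -- What remains is supported at corners of the hexagon.
  have d1 : P n n = Q (n + 1) n := by simpa using c2 n (n + 1)
  have d2 : P (n + 1) n = Q (n + 1) (n + 1) := by simpa using c2 (n + 1) (n + 1)
  rw [hexagonSum, T1, T2, T3, T4, T5, T6, O, I]
  linear_combination (m (n, n)) * d1 + m (n, 0) * c0 (n + 1) + m (0, n) * c0 n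
    - m (-n, 0) * d2 + m (-n, -n) * c1 n - m (0, -n) * c2 n n

/-- The exponents of hexagonal norm at most `N`. -/
noncomputable def hexBall (N : ℕ) : Finset (ℤ × ℤ) :=
  (Finset.Icc (-(N : ℤ)) N ×ˢ Finset.Icc (-(N : ℤ)) N).filter fun p => hexNorm p ≤ N

theorem mem_hexBall {N : ℕ} {p : ℤ × ℤ} : p ∈ hexBall N ↔ hexNorm p ≤ N := by
  simp only [hexBall, Finset.mem_filter, Finset.mem_product, Finset.mem_Icc, and_iff_right_iff_imp]
  intro h
  unfold hexNorm at h
  omega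

/-- The sides are half-open, each containing exactly one of its two corners, so that for n ≥ 1 they
partition the hexagon. -/
theorem hexNorm_eq_iff {n : ℕ} (hn : 1 ≤ n) (x y : ℤ) : hexNorm (x, y) = n ↔
    (x = n ∧ 0 ≤ y ∧ y < n) ∨ (y = n ∧ 1 ≤ x ∧ x < n + 1) ∨ (y = x + n ∧ 0 ≤ -x ∧ -x < n) ∨
    (x = -n ∧ 1 ≤ y + n ∧ y + n < n + 1) ∨ (y = -n ∧ 0 ≤ x + n ∧ x + n < n) ∨
    (y = x - n ∧ 1 ≤ -y ∧ -y < n + 1) := by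
  unfold hexNorm
  dsimp only
  omega

theorem sum_hexBall_succ (F : ℤ × ℤ → ℂ) (N : ℕ) :
    ∑ p ∈ hexBall (N + 1), F p = ∑ p ∈ hexBall N, F p + hexagonSum F (N + 1) := by
  set n := N + 1 with hn
  let s : Finset ℕ := Finset.range n
  let g1 : ℕ → ℤ × ℤ := fun b => (n, b)
  let g2 : ℕ → ℤ × ℤ := fun b => (b + 1, n)
  let g3 : ℕ → ℤ × ℤ := fun b => (-b, n - b)
  let g4 : ℕ → ℤ × ℤ := fun b => (-n, b + 1 - n)
  let g5 : ℕ → ℤ × ℤ := fun b => (b - n, -n)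
  let g6 : ℕ → ℤ × ℤ := fun b => (n - (b + 1), -(b + 1))
  have himg : ∀ g : ℕ → ℤ × ℤ, Function.Injective g →
      ∑ p ∈ s.image g, F p = ∑ b ∈ s, F (g b) := fun g hg => Finset.sum_image hg.injOn
  have j1 : Function.Injective g1 := fun b c h => by simp only [g1, Prod.mk.injEq] at h; omega
  have j2 : Function.Injective g2 := fun b c h => by simp only [g2, Prod.mk.injEq] at h; omega
  have j3 : Function.Injective g3 := fun b c h => by simp only [g3, Prod.mk.injEq] at h; omega
  have j4 : Function.Injective g4 := fun b c h => by simp only [g4, Prod.mk.injEq] at h; omega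
  have j5 : Function.Injective g5 := fun b c h => by simp only [g5, Prod.mk.injEq] at h; omega
  have j6 : Function.Injective g6 := fun b c h => by simp only [g6, Prod.mk.injEq] at h; omega
  have k1 : ∀ x y : ℤ, (x, y) ∈ s.image g1 ↔ x = n ∧ 0 ≤ y ∧ y < n := fun x y => by
    simp only [Finset.mem_image, Finset.mem_range, s, g1, Prod.mk.injEq]
    exact ⟨fun ⟨b, hb⟩ => by omega, fun h => ⟨y.toNat, by omega⟩⟩
  have k2 : ∀ x y : ℤ, (x, y) ∈ s.image g2 ↔ y = n ∧ 1 ≤ x ∧ x < n + 1 := fun x y => by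
    simp only [Finset.mem_image, Finset.mem_range, s, g2, Prod.mk.injEq]
    exact ⟨fun ⟨b, hb⟩ => by omega, fun h => ⟨(x - 1).toNat, by omega⟩⟩
  have k3 : ∀ x y : ℤ, (x, y) ∈ s.image g3 ↔ y = x + n ∧ 0 ≤ -x ∧ -x < n := fun x y => by
    simp only [Finset.mem_image, Finset.mem_range, s, g3, Prod.mk.injEq]
    exact ⟨fun ⟨b, hb⟩ => by omega, fun h => ⟨(-x).toNat, by omega⟩⟩
  have k4 : ∀ x y : ℤ, (x, y) ∈ s.image g4 ↔ x = -n ∧ 1 ≤ y + n ∧ y + n < n + 1 := fun x y => by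
    simp only [Finset.mem_image, Finset.mem_range, s, g4, Prod.mk.injEq]
    exact ⟨fun ⟨b, hb⟩ => by omega, fun h => ⟨(y + n - 1).toNat, by omega⟩⟩
  have k5 : ∀ x y : ℤ, (x, y) ∈ s.image g5 ↔ y = -n ∧ 0 ≤ x + n ∧ x + n < n := fun x y => by
    simp only [Finset.mem_image, Finset.mem_range, s, g5, Prod.mk.injEq]
    exact ⟨fun ⟨b, hb⟩ => by omega, fun h => ⟨(x + n).toNat, by omega⟩⟩
  have k6 : ∀ x y : ℤ, (x, y) ∈ s.image g6 ↔ y = x - n ∧ 1 ≤ -y ∧ -y < n + 1 := fun x y => by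
    simp only [Finset.mem_image, Finset.mem_range, s, g6, Prod.mk.injEq]
    exact ⟨fun ⟨b, hb⟩ => by omega, fun h => ⟨(-y - 1).toNat, by omega⟩⟩
  have hball : hexBall n = hexBall N ∪ s.image g1 ∪ s.image g2 ∪ s.image g3 ∪ s.image g4 ∪
      s.image g5 ∪ s.image g6 := by
    ext ⟨x, y⟩
    have hle : hexNorm (x, y) ≤ n ↔ hexNorm (x, y) ≤ N ∨ hexNorm (x, y) = n := by omega
    rw [mem_hexBall, hle, hexNorm_eq_iff (by omega)]
    simp only [Finset.mem_union, mem_hexBall, k1, k2, k3, k4, k5, k6, or_assoc]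
  have k0 : ∀ x y : ℤ, (x, y) ∈ hexBall N ↔ x ≤ N ∧ -x ≤ N ∧ y ≤ N ∧ -y ≤ N ∧ x - y ≤ N ∧
      y - x ≤ N := fun x y => by
    rw [mem_hexBall, hexNorm]
    dsimp only
    omega
  rw [hball, Finset.sum_union, Finset.sum_union, Finset.sum_union, Finset.sum_union,
    Finset.sum_union, Finset.sum_union, himg _ j1, himg _ j2, himg _ j3, himg _ j4, himg _ j5,
    himg _ j6, hexagonSum]
  · ring
  all_goals
    rw [Finset.disjoint_right]
    rintro ⟨x, y⟩ h
    simp only [Finset.mem_union, k0, k1, k2, k3, k4, k5, k6] at h ⊢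
    omega

theorem tendsto_sum_hexBall {F : ℤ × ℤ → ℂ} {v : ℂ} (h : HasSum F v) :
    Tendsto (fun N => ∑ p ∈ hexBall N, F p) atTop (nhds v) := by
  have h' : Tendsto (fun s : Finset (ℤ × ℤ) => ∑ p ∈ s, F p) atTop (nhds v) := by
    simpa [HasSum] using h
  refine h'.comp (tendsto_atTop_finset_of_monotone (fun m n hmn p hp => ?_) fun p =>
    ⟨hexNorm p, mem_hexBall.2 le_rfl⟩)
  rw [mem_hexBall] at hp ⊢
  exact hp.trans hmn

/-- Telescoping: the inner part of each block completes the hexagon begun by the outer part of the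
preceding one, so only the last outer part is left over. -/
theorem sum_blocks_eq {a : ℤ × ℤ → ℂ} {P Q : ℕ → ℤ → ℂ} (m : ℤ × ℤ → ℂ)
    (hsw : ∀ p, a p.swap = a p)
    (hr : ∀ (n : ℕ) (b : ℤ), a (n, b) = P n b + Q (n + 1) b)
    (ht : ∀ (n : ℕ) (b : ℤ), a (n - b, -b) = Q n b + P (n + 1) b)
    (hl : ∀ (n : ℕ) (b : ℤ), a (b - n, -n) = P n (b - 1) + Q (n + 1) (b + 1))
    (c0 : ∀ n, Q n 0 = P n 0) (c1 : ∀ n, P n (-1) = Q (n + 1) 1)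
    (c2 : ∀ n b : ℕ, P n (b - 1) = Q b n) (N : ℕ) :
    ∑ n ∈ Finset.Icc 1 (N + 1), (outerBlock P Q m n + innerBlock P Q m n) =
      ∑ p ∈ hexBall N, a p * m p + outerBlock P Q m (N + 1) := by
  induction N with
  | zero =>
    have h0 : hexBall 0 = {(0, 0)} := by
      ext ⟨x, y⟩
      simp only [mem_hexBall, hexNorm, Finset.mem_singleton, Prod.mk.injEq]
      omega
    -- The hexagon of radius 0 is one point, where the inner block has coefficient 2 P(1, 0); the
    -- relations give the same value for a(0, 0).
    have e1 := ht 0 0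
    rw [c0] at e1
    have e2 : P 0 0 = P 1 0 := by
      have := c2 0 1
      simp only [Nat.cast_one, sub_self, Nat.cast_zero] at this
      rw [this, c0]
    have e3 : innerBlock P Q m 1 = 2 * P 1 0 * m (0, 0) := by
      simp [innerBlock]
      ring
    simp only [Nat.cast_zero, sub_self, neg_zero, zero_add] at e1
    simp only [zero_add, Finset.Icc_self, Finset.sum_singleton, h0, e3, e1, e2]
    ring
  | succ N ih =>
    rw [Finset.sum_Icc_succ_top (by omega), ih, sum_hexBall_succ,
      hexagonSum_eq_blocks m hsw hr ht hl c0 c1 c2 (Nat.le_add_left 1 N)]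
    ring

/-! ### Minimal solutions as Laurent polynomials. -/

/-- With b = n - 1 - j and 0 ≤ b < n, the first bracket has hexagonal norm n and the second n - 1.
-/
theorem minimalSolution_odd (n : ℕ) (b : ℤ) (q : ℂ × ℂ) :
    minimalSolution n (2 * b + 1 - n) q =
      (laurentMonomial (n, b) q + laurentMonomial (b, n) q + laurentMonomial (b + 1 - n, -n) q
        + laurentMonomial (-n, b + 1 - n) q)
      + (laurentMonomial (n - 1 - b, -b) q + laurentMonomial (-b, n - 1 - b) q) := by
  have e : 2 * b + 1 - (n : ℤ) = n - 1 - 2 * (n - 1 - b) := by ring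
  have e1 : (n : ℤ) - 1 - (n - 1 - b) = b := by ring
  have e2 : b + 1 - (n : ℤ) = -(n - 1 - b) := by ring
  rw [e, minimalSolution_typeOne]
  simp only [minimalHalfOne, laurentMonomial, e1, e2, zpow_neg, mul_inv, div_eq_mul_inv]
  ring

/-- With b = n - j and 1 ≤ b < n the norms are reversed: n - 1 in the first bracket and n in the
second. -/
theorem minimalSolution_even (n : ℕ) (b : ℤ) (q : ℂ × ℂ) :
    minimalSolution n (2 * b - n) q =
      (laurentMonomial (n - 1, b) q + laurentMonomial (b, n - 1) q + laurentMonomial (b - n, 1 - n) q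
        + laurentMonomial (1 - n, b - n) q)
      + (laurentMonomial (n - b, -b) q + laurentMonomial (-b, n - b) q) := by
  have e : 2 * b - (n : ℤ) = n - 2 * (n - b) := by ring
  have e1 : (n : ℤ) - (n - b) = b := by ring
  have e2 : b - (n : ℤ) = -(n - b) := by ring
  have e3 : 1 - (n : ℤ) = -(n - 1) := by ring
  rw [e, minimalSolution_typeTwo]
  simp only [minimalHalfTwo, laurentMonomial, e1, e2, e3, zpow_neg, mul_inv,
    div_eq_mul_inv]
  ring

/-- The coefficient of `L_{n,i}` in terms of the coefficients `P`, `Q` of the minimal solutions of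
the two types. -/
def minimalCoeff (P Q : ℕ → ℤ → ℂ) (n : ℕ) (i : ℤ) : ℂ :=
  if Odd ((n : ℤ) - i) then P n ((n - 1 + i) / 2) else Q n ((n + i) / 2)

theorem minimalCoeff_odd (P Q : ℕ → ℤ → ℂ) (n : ℕ) (b : ℤ) :
    minimalCoeff P Q n (2 * b + 1 - n) = P n b := by
  have h1 : Odd ((n : ℤ) - (2 * b + 1 - n)) := ⟨n - b - 1, by ring⟩
  rw [minimalCoeff, if_pos h1]
  congr 1
  omega

theorem minimalCoeff_even (P Q : ℕ → ℤ → ℂ) (n : ℕ) (b : ℤ) :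
    minimalCoeff P Q n (2 * b - n) = Q n b := by
  have h1 : ¬ Odd ((n : ℤ) - (2 * b - n)) := by
    rw [Int.not_odd_iff_even]; exact ⟨n - b, by ring⟩
  rw [minimalCoeff, if_neg h1]
  congr 1
  omega

theorem exists_index_parity {n : ℕ} {i : ℤ} (hi : |i| ≤ (n : ℤ) - 1) :
    (∃ b : ℕ, b < n ∧ i = 2 * b + 1 - n) ∨ (∃ b : ℕ, 1 ≤ b ∧ b < n ∧ i = 2 * b - n) := by
  rw [abs_le] at hi
  rcases Int.even_or_odd ((n : ℤ) - i) with ⟨k, hk⟩ | ⟨k, hk⟩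
  · exact Or.inr ⟨(n - k).toNat, by omega⟩
  · exact Or.inl ⟨(n - 1 - k).toNat, by omega⟩

theorem sum_Icc_parity (f : ℤ → ℂ) (n : ℕ) :
    ∑ i ∈ Finset.Icc (-(n : ℤ) + 1) ((n : ℤ) - 1), f i =
      ∑ b ∈ Finset.range n, f (2 * b + 1 - n) + ∑ b ∈ Finset.Ico 1 n, f (2 * b - n) := by
  have j1 : Function.Injective fun b : ℕ => 2 * (b : ℤ) + 1 - n := fun b c h => by
    dsimp only at h; omega
  have j2 : Function.Injective fun b : ℕ => 2 * (b : ℤ) - n := fun b c h => by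
    dsimp only at h; omega
  rw [← Finset.sum_image (g := fun b : ℕ => 2 * (b : ℤ) + 1 - n) j1.injOn,
    ← Finset.sum_image (g := fun b : ℕ => 2 * (b : ℤ) - n) j2.injOn, ← Finset.sum_union]
  · refine Finset.sum_congr ?_ fun _ _ => rfl
    ext i
    simp only [Finset.mem_union, Finset.mem_image, Finset.mem_range, Finset.mem_Ico,
      Finset.mem_Icc]
    constructor
    · intro h
      have := exists_index_parity (n := n) (i := i) (by rw [abs_le]; omega)
      rcases this with ⟨b, h1, h2⟩ | ⟨b, h1, h2, h3⟩
      · exact Or.inl ⟨b, h1, h2.symm⟩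
      · exact Or.inr ⟨b, ⟨h1, h2⟩, h3.symm⟩
    · rintro (⟨b, hb, rfl⟩ | ⟨b, hb, rfl⟩) <;> omega
  · rw [Finset.disjoint_left]
    intro i h1 h2
    obtain ⟨b, -, rfl⟩ := Finset.mem_image.1 h1
    obtain ⟨c, -, hc⟩ := Finset.mem_image.1 h2
    omega

theorem sum_minimalCoeff_eq_blocks (P Q : ℕ → ℤ → ℂ) (n : ℕ) (q : ℂ × ℂ) :
    ∑ i ∈ Finset.Icc (-(n : ℤ) + 1) ((n : ℤ) - 1), minimalCoeff P Q n i * minimalSolution n i q =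
      outerBlock P Q (fun p => laurentMonomial p q) n +
        innerBlock P Q (fun p => laurentMonomial p q) n := by
  rw [sum_Icc_parity]
  simp only [minimalCoeff_odd, minimalCoeff_even, minimalSolution_odd, minimalSolution_even,
    outerBlock, innerBlock]
  simp only [mul_add, Finset.sum_add_distrib]
  ring

/-! ### Estimates and uniform convergence. -/

theorem norm_add_six_le {a b c d e f : ℂ} {E : ℝ} (ha : ‖a‖ ≤ E) (hb : ‖b‖ ≤ E) (hc : ‖c‖ ≤ E)
    (hd : ‖d‖ ≤ E) (he : ‖e‖ ≤ E) (hf : ‖f‖ ≤ E) :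
    ‖(a + b + c + d) + (e + f)‖ ≤ 6 * E := by
  have h1 := norm_add_le (a + b + c + d) (e + f)
  have h2 := norm_add_le (a + b + c) d
  have h3 := norm_add_le (a + b) c
  have h4 := norm_add_le a b
  have h5 := norm_add_le e f
  linarith

theorem norm_laurentMonomial_le_pow {q : ℂ × ℂ} (h1 : q.1 ≠ 0) (h2 : q.2 ≠ 0) {c : ℝ}
    (hc : hexSize q ≤ c) {p : ℤ × ℤ} {n : ℕ} (h : hexNorm p ≤ n) :
    ‖laurentMonomial p q‖ ≤ Real.exp c ^ n := by
  refine (norm_laurentMonomial_le h1 h2 p).trans ?_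
  rw [← Real.exp_nat_mul, Real.exp_le_exp, mul_comm]
  have h0 := hexSize_nonneg q
  have : (hexNorm p : ℝ) ≤ n := by exact_mod_cast h
  exact mul_le_mul this hc h0 (by positivity)

theorem norm_minimalSolution_le {q : ℂ × ℂ} (h1 : q.1 ≠ 0) (h2 : q.2 ≠ 0) {c : ℝ}
    (hc : hexSize q ≤ c) {n : ℕ} {i : ℤ} (hi : |i| ≤ (n : ℤ) - 1) :
    ‖minimalSolution n i q‖ ≤ 6 * Real.exp c ^ n := by
  rcases exists_index_parity hi with ⟨b, hb, rfl⟩ | ⟨b, hb1, hb, rfl⟩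
  · rw [minimalSolution_odd]
    apply norm_add_six_le <;> apply norm_laurentMonomial_le_pow h1 h2 hc <;> unfold hexNorm <;>
      omega
  · rw [minimalSolution_even]
    apply norm_add_six_le <;> apply norm_laurentMonomial_le_pow h1 h2 hc <;> unfold hexNorm <;>
      omega

theorem norm_outerBlock_le {P Q : ℕ → ℤ → ℂ} {D ρ : ℝ} (hP : ∀ n b, ‖P n b‖ ≤ D * ρ ^ n)
    (hQ : ∀ n b, ‖Q n b‖ ≤ D * ρ ^ n) {q : ℂ × ℂ} (h1 : q.1 ≠ 0) (h2 : q.2 ≠ 0) {c : ℝ}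
    (hc : hexSize q ≤ c) (n : ℕ) :
    ‖outerBlock P Q (fun p => laurentMonomial p q) n‖ ≤ 6 * D * (n * (ρ * Real.exp c) ^ n) := by
  have hm : ∀ p : ℤ × ℤ, hexNorm p ≤ n → ‖laurentMonomial p q‖ ≤ Real.exp c ^ n := fun p h =>
    norm_laurentMonomial_le_pow h1 h2 hc h
  have hD : 0 ≤ D * ρ ^ n := (norm_nonneg _).trans (hP n 0)
  have s1 : ∀ b ∈ Finset.range n, ‖P n b * (laurentMonomial (n, b) q + laurentMonomial (b, n) q
      + laurentMonomial (b + 1 - n, -n) q + laurentMonomial (-n, b + 1 - n) q)‖ ≤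
      D * ρ ^ n * (4 * Real.exp c ^ n) := by
    intro b hb
    rw [Finset.mem_range] at hb
    rw [norm_mul]
    refine mul_le_mul (hP n b) ?_ (norm_nonneg _) hD
    have e1 := hm (n, b) (by unfold hexNorm; omega)
    have e2 := hm (b, n) (by unfold hexNorm; omega)
    have e3 := hm (b + 1 - n, -n) (by unfold hexNorm; omega)
    have e4 := hm (-n, b + 1 - n) (by unfold hexNorm; omega)
    refine (norm_add₃_le.trans (add_le_add_left (add_le_add_left (norm_add_le _ _) _) _)).trans ?_
    linarith
  have s2 : ∀ b ∈ Finset.Ico 1 n, ‖Q n b * (laurentMonomial (n - b, -b) q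
      + laurentMonomial (-b, n - b) q)‖ ≤ D * ρ ^ n * (2 * Real.exp c ^ n) := by
    intro b hb
    rw [Finset.mem_Ico] at hb
    rw [norm_mul]
    refine mul_le_mul (hQ n b) ?_ (norm_nonneg _) hD
    have e1 := hm (n - b, -b) (by unfold hexNorm; omega)
    have e2 := hm (-b, n - b) (by unfold hexNorm; omega)
    refine (norm_add_le _ _).trans ?_
    linarith
  have t1 := norm_sum_le_of_le _ s1
  have t2 := norm_sum_le_of_le _ s2
  rw [Finset.sum_const, Finset.card_range, nsmul_eq_mul] at t1
  rw [Finset.sum_const, Nat.card_Ico, nsmul_eq_mul] at t2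
  have t3 : ((n - 1 : ℕ) : ℝ) * (D * ρ ^ n * (2 * Real.exp c ^ n)) ≤
      n * (D * ρ ^ n * (2 * Real.exp c ^ n)) :=
    mul_le_mul_of_nonneg_right (by exact_mod_cast Nat.sub_le n 1) (by positivity)
  refine (norm_add_le _ _).trans ((add_le_add t1 (t2.trans t3)).trans (le_of_eq ?_))
  rw [mul_pow]
  ring

/-- The Weierstrass test; the vanishing term at 0 allows sums to start at 1. The general target E
serves both the complex series and the real series of absolute values. -/
theorem tendstoUniformlyOn_sum_Icc {E : Type*} [NormedAddCommGroup E] [CompleteSpace E]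
    {f : ℕ → ℂ × ℂ → E} {u : ℕ → ℝ} {S : Set (ℂ × ℂ)} (h0 : ∀ q, f 0 q = 0) (hu : Summable u)
    (hf : ∀ n, ∀ q ∈ S, ‖f n q‖ ≤ u n) :
    TendstoUniformlyOn (fun N q => ∑ n ∈ Finset.Icc 1 N, f n q) (fun q => ∑' n, f n q) atTop S := by
  have h := tendstoUniformlyOn_tsum_nat hu hf
  intro v hv
  filter_upwards [(tendsto_add_atTop_nat 1).eventually (h v hv)] with N hN q hq
  have : ∑ n ∈ Finset.Icc 1 N, f n q = ∑ n ∈ Finset.range (N + 1), f n q := by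
    clear hN
    induction N with
    | zero => simp [h0]
    | succ N ih => rw [Finset.sum_Icc_succ_top (by omega), ih, ← Finset.sum_range_succ]
  simpa only [this] using hN q hq

theorem summable_blockBound {D ρ c : ℝ} (h0 : 0 ≤ ρ * Real.exp c) (h1 : ρ * Real.exp c < 1) :
    Summable fun n : ℕ => 12 * D * (n * (ρ * Real.exp c) ^ n) := by
  have := summable_pow_mul_geometric_of_norm_lt_one 1 (r := ρ * Real.exp c)
    (by rwa [Real.norm_eq_abs, abs_of_nonneg h0])
  simpa using this.mul_left (12 * D)

theorem sum_norm_block_le {α : ℕ → ℤ → ℂ} {D ρ : ℝ}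
    (hα : ∀ (n : ℕ) (i : ℤ), ‖α n i‖ ≤ D * ρ ^ n) {q : ℂ × ℂ} (h1 : q.1 ≠ 0) (h2 : q.2 ≠ 0) {c : ℝ}
    (hc : hexSize q ≤ c) (n : ℕ) :
    ∑ i ∈ Finset.Icc (-(n : ℤ) + 1) ((n : ℤ) - 1), ‖α n i * minimalSolution n i q‖ ≤
      12 * D * (n * (ρ * Real.exp c) ^ n) := by
  have hD : 0 ≤ D * ρ ^ n := (norm_nonneg _).trans (hα n 0)
  have s : ∀ i ∈ Finset.Icc (-(n : ℤ) + 1) ((n : ℤ) - 1), ‖α n i * minimalSolution n i q‖ ≤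
      D * ρ ^ n * (6 * Real.exp c ^ n) := fun i hi => by
    rw [Finset.mem_Icc] at hi
    rw [norm_mul]
    exact mul_le_mul (hα n i) (norm_minimalSolution_le h1 h2 hc (by rw [abs_le]; omega))
      (norm_nonneg _) hD
  refine (Finset.sum_le_card_nsmul _ _ _ s).trans ?_
  have hcard : ((Finset.Icc (-(n : ℤ) + 1) ((n : ℤ) - 1)).card : ℝ) ≤ 2 * n := by
    rw [Int.card_Icc]
    have : ((n : ℤ) - 1 + 1 - (-(n : ℤ) + 1)).toNat ≤ 2 * n := by omega
    exact_mod_cast this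
  rw [nsmul_eq_mul]
  refine (mul_le_mul_of_nonneg_right hcard (by positivity)).trans (le_of_eq ?_)
  rw [mul_pow]
  ring

/-! ### Uniqueness of the coefficients. -/

theorem continuous_minimalSolution_torusPoint (n : ℕ) (i : ℤ) :
    Continuous fun t => minimalSolution n i (torusPoint 1 1 t) := by
  have hc := continuous_laurentMonomial_torusPoint
  rcases Int.even_or_odd ((n : ℤ) + i) with ⟨k, hk⟩ | ⟨k, hk⟩
  · obtain rfl : i = 2 * k - n := by omega
    simp only [minimalSolution_even]
    exact ((((hc _).add (hc _)).add (hc _)).add (hc _)).add ((hc _).add (hc _))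
  · obtain rfl : i = 2 * k + 1 - n := by omega
    simp only [minimalSolution_odd]
    exact ((((hc _).add (hc _)).add (hc _)).add (hc _)).add ((hc _).add (hc _))

/-- The restriction of the minimal solution to the unit torus. -/
noncomputable def torusMinimalSolution (n : ℕ) (i : ℤ) : C(UnitAddTorus (Fin 2), ℂ) :=
  ⟨fun t => minimalSolution n i (torusPoint 1 1 t), continuous_minimalSolution_torusPoint n i⟩

/-- The restriction of a Laurent monomial to the unit torus. -/
noncomputable def torusMonomial (p : ℤ × ℤ) : C(UnitAddTorus (Fin 2), ℂ) :=
  ⟨fun t => laurentMonomial p (torusPoint 1 1 t), continuous_laurentMonomial_torusPoint p⟩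

theorem torusMinimalSolution_odd (n : ℕ) (b : ℤ) :
    torusMinimalSolution n (2 * b + 1 - n) =
      (torusMonomial (n, b) + torusMonomial (b, n) + torusMonomial (b + 1 - n, -n)
        + torusMonomial (-n, b + 1 - n))
      + (torusMonomial (n - 1 - b, -b) + torusMonomial (-b, n - 1 - b)) := by
  ext t
  exact minimalSolution_odd n b _

theorem torusMinimalSolution_even (n : ℕ) (b : ℤ) :
    torusMinimalSolution n (2 * b - n) =
      (torusMonomial (n - 1, b) + torusMonomial (b, n - 1) + torusMonomial (b - n, 1 - n)
        + torusMonomial (1 - n, b - n))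
      + (torusMonomial (n - b, -b) + torusMonomial (-b, n - b)) := by
  ext t
  exact minimalSolution_even n b _

/-- A minimal solution has a Laurent coefficient that vanishes for all other minimal solutions of
the same or a higher level. -/
theorem exists_minimalSolution_dual {k : ℕ} {i : ℤ} (hi : |i| ≤ (k : ℤ) - 1) :
    ∃ φ : C(UnitAddTorus (Fin 2), ℂ) →L[ℂ] ℂ, φ (torusMinimalSolution k i) ≠ 0 ∧
      ∀ (n : ℕ) (j : ℤ), k ≤ n → |j| ≤ (n : ℤ) - 1 → (n = k → j ≠ i) →
        φ (torusMinimalSolution n j) = 0 := by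
  rcases exists_index_parity hi with ⟨b, hb, rfl⟩ | ⟨b, hb1, hb, rfl⟩
  -- An inner monomial, of norm k - 1, cannot occur at levels above k; at level k its position on
  -- the hexagon identifies the solution. The two inner monomials coincide if k = 1, so the value of
  -- φ is 1 or 2.
  · obtain ⟨φ, hφ⟩ := exists_laurentMonomial_dual (k - 1 - b, -b)
    have hm : ∀ m, φ (torusMonomial m) = if ((k : ℤ) - 1 - b, -(b : ℤ)) = m then 1 else 0 :=
      fun m => hφ m _ fun t => rfl
    refine ⟨φ, ?_, fun n j hkn hj hne => ?_⟩
    · rw [torusMinimalSolution_odd]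
      simp only [map_add, hm, Prod.mk.injEq]
      rw [if_neg (by omega), if_neg (by omega), if_neg (by omega), if_neg (by omega)]
      split_ifs <;> norm_num
    · rcases exists_index_parity hj with ⟨c, hc, rfl⟩ | ⟨c, hc1, hc, rfl⟩
      · rw [torusMinimalSolution_odd]
        simp only [map_add, hm, Prod.mk.injEq]
        rw [if_neg (by omega), if_neg (by omega), if_neg (by omega), if_neg (by omega),
          if_neg (by omega), if_neg (by omega)]
        norm_num
      · rw [torusMinimalSolution_even]
        simp only [map_add, hm, Prod.mk.injEq]
        rw [if_neg (by omega), if_neg (by omega), if_neg (by omega), if_neg (by omega),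
          if_neg (by omega), if_neg (by omega)]
        norm_num
  -- Again an inner monomial; it coincides with its mirror image (b, k - 1) exactly when b = k - 1.
  · obtain ⟨φ, hφ⟩ := exists_laurentMonomial_dual (k - 1, b)
    have hm : ∀ m, φ (torusMonomial m) = if ((k : ℤ) - 1, (b : ℤ)) = m then 1 else 0 :=
      fun m => hφ m _ fun t => rfl
    refine ⟨φ, ?_, fun n j hkn hj hne => ?_⟩
    · rw [torusMinimalSolution_even]
      simp only [map_add, hm, Prod.mk.injEq]
      rw [if_neg (c := (k : ℤ) - 1 = b - k ∧ _) (by omega),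
        if_neg (c := (k : ℤ) - 1 = 1 - k ∧ _) (by omega),
        if_neg (c := (k : ℤ) - 1 = k - b ∧ _) (by omega),
        if_neg (c := (k : ℤ) - 1 = -b ∧ _) (by omega)]
      split_ifs <;> norm_num
    · rcases exists_index_parity hj with ⟨c, hc, rfl⟩ | ⟨c, hc1, hc, rfl⟩
      · rw [torusMinimalSolution_odd]
        simp only [map_add, hm, Prod.mk.injEq]
        rw [if_neg (by omega), if_neg (by omega), if_neg (by omega), if_neg (by omega),
          if_neg (by omega), if_neg (by omega)]
        norm_num
      · rw [torusMinimalSolution_even]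
        simp only [map_add, hm, Prod.mk.injEq]
        rw [if_neg (by omega), if_neg (by omega), if_neg (by omega), if_neg (by omega),
          if_neg (by omega), if_neg (by omega)]
        norm_num

theorem coeff_eq_zero_of_tendsto {γ : ℕ → ℤ → ℂ}
    (h : TendstoUniformlyOn (minimalPartialSum γ) 0 atTop {q | ‖q.1‖ = 1 ∧ ‖q.2‖ = 1})
    (n : ℕ) : ∀ i : ℤ, |i| ≤ (n : ℤ) - 1 → γ n i = 0 := by
  induction n using Nat.strong_induction_on with
  | _ k ih =>
    intro i hi
    obtain ⟨φ, hφ1, hφ2⟩ := exists_minimalSolution_dual hi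
    let F : ℕ → C(UnitAddTorus (Fin 2), ℂ) := fun N =>
      ∑ n ∈ Finset.Icc 1 N, ∑ j ∈ Finset.Icc (-(n : ℤ) + 1) ((n : ℤ) - 1),
        γ n j • torusMinimalSolution n j
    have hF : Tendsto F atTop (nhds 0) := by
      rw [ContinuousMap.tendsto_iff_tendstoUniformly]
      intro v hv
      filter_upwards [h v hv] with N hN t
      have := hN (torusPoint 1 1 t) ⟨by simp [torusPoint, norm_unitAddCircle_toCircle (t 0)],
        by simp [torusPoint, norm_unitAddCircle_toCircle (t 1)]⟩
      simpa [F, minimalPartialSum, torusMinimalSolution, ContinuousMap.sum_apply] using this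
    -- Lower levels drop out by the induction hypothesis, all other terms by the choice of φ.
    have hval : ∀ N, k ≤ N → φ (F N) = γ k i * φ (torusMinimalSolution k i) := by
      intro N hN
      simp only [F, map_sum, map_smul, smul_eq_mul]
      have hk : 1 ≤ k := by
        have := abs_nonneg i
        omega
      rw [Finset.sum_eq_single_of_mem k (Finset.mem_Icc.2 ⟨hk, hN⟩),
        Finset.sum_eq_single_of_mem i (by rw [abs_le] at hi; rw [Finset.mem_Icc]; omega)]
      · intro j hj hji
        rw [Finset.mem_Icc] at hj
        rw [hφ2 k j le_rfl (by rw [abs_le]; omega) fun _ => hji, mul_zero]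
      · intro n _ hnk
        refine Finset.sum_eq_zero fun j hj => ?_
        rw [Finset.mem_Icc] at hj
        have hj' : |j| ≤ (n : ℤ) - 1 := by rw [abs_le]; omega
        rcases lt_or_gt_of_ne hnk with hlt | hgt
        · rw [ih n hlt j hj', zero_mul]
        · rw [hφ2 n j hgt.le hj' fun h => absurd h hnk, mul_zero]
    have hlim := (φ.continuous.tendsto 0).comp hF
    rw [map_zero] at hlim
    have hconst : Tendsto (fun N => φ (F N)) atTop (nhds (γ k i * φ (torusMinimalSolution k i))) :=
      tendsto_const_nhds.congr' (by
        filter_upwards [eventually_ge_atTop k] with N hN using (hval N hN).symm)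
    exact (mul_eq_zero.1 (tendsto_nhds_unique hconst hlim)).resolve_right hφ1

theorem isCompact_unitTorus : IsCompact {q : ℂ × ℂ | ‖q.1‖ = 1 ∧ ‖q.2‖ = 1} := by
  have : {q : ℂ × ℂ | ‖q.1‖ = 1 ∧ ‖q.2‖ = 1} =
      Metric.sphere (0 : ℂ) 1 ×ˢ Metric.sphere (0 : ℂ) 1 := by
    ext q
    simp
  rw [this]
  exact (isCompact_sphere _ _).prod (isCompact_sphere _ _)

theorem minimalSeries_coeff_unique {K : ℝ} (hK : 0 < K) {M : ℂ × ℂ → ℂ} {α β : ℕ → ℤ → ℂ}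
    (hα : MinimalSeriesConverges K α M) (hβ : MinimalSeriesConverges K β M) (n : ℕ) (i : ℤ)
    (hi : |i| ≤ (n : ℤ) - 1) : β n i = α n i := by
  have hsub : {q : ℂ × ℂ | ‖q.1‖ = 1 ∧ ‖q.2‖ = 1} ⊆ cyclicAnnulus K := fun q hq =>
    mem_cyclicAnnulus_of_norm_eq_one hK hq.1 hq.2
  have h := (hβ _ hsub isCompact_unitTorus).sub (hα _ hsub isCompact_unitTorus)
  have e1 : minimalPartialSum β - minimalPartialSum α =
      minimalPartialSum fun n i => β n i - α n i := by
    ext N q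
    simp only [Pi.sub_apply, minimalPartialSum, sub_mul, Finset.sum_sub_distrib]
  rw [sub_self, e1] at h
  exact sub_eq_zero.1 (coeff_eq_zero_of_tendsto (γ := fun n i => β n i - α n i) h n i hi)

/-! ### Assembling the expansion. -/

theorem theoremB (K : ℝ) (hK : 0 < K) (M : ℂ × ℂ → ℂ)
    (hM : M ∈ symmetricSolutions naiveDelta K) :
    ∃ α : ℕ → ℤ → ℂ,
      MinimalSeriesConverges K α M ∧
      MinimalSeriesAbsConverges K α ∧
      (∀ K' : ℝ, 0 < K' → K' < K → ∃ C' : ℝ, 0 < C' ∧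
        ∀ (n : ℕ) (i : ℤ), |i| ≤ (n : ℤ) - 1 → ‖α n i‖ ≤ C' * Real.exp (-K' * n)) ∧
      (∀ β : ℕ → ℤ → ℂ, MinimalSeriesConverges K β M →
        ∀ (n : ℕ) (i : ℤ), |i| ≤ (n : ℤ) - 1 → β n i = α n i) := by
  obtain ⟨hd, hsymm, hL⟩ := hM
  set a := laurentCoeff M
  have hsw : ∀ p, a p.swap = a p := laurentCoeff_swap hK hd hsymm
  have hrel := laurentCoeff_cyclicLeibniz hK hd hL
  set P := coeffOne a
  set Q := coeffTwo a
  set α := minimalCoeff P Q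
  have hexp : ∀ K' : ℝ, 0 < K' → Real.exp (-K') < 1 := fun K' h => by simpa using h
  have hbound : ∀ K' : ℝ, 0 < K' → K' < K → ∃ D : ℝ, 0 ≤ D ∧
      (∀ n b, ‖P n b‖ ≤ D * Real.exp (-K') ^ n) ∧ (∀ n b, ‖Q n b‖ ≤ D * Real.exp (-K') ^ n) ∧
      ∀ n i, ‖α n i‖ ≤ D * Real.exp (-K') ^ n := by
    intro K' h0 h1
    obtain ⟨C, hC, ha⟩ := exists_norm_laurentCoeff_le h0 h1 hd
    have hP := norm_coeffOne_le hC (Real.exp_pos _).le (hexp K' h0) ha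
    have hQ := norm_coeffTwo_le hC (Real.exp_pos _).le (hexp K' h0) ha
    refine ⟨C / (1 - Real.exp (-K')), div_nonneg hC (by linarith [hexp K' h0]), hP, hQ,
      fun n i => ?_⟩
    simp only [α, minimalCoeff]
    split_ifs
    · exact hP _ _
    · exact hQ _ _
  have hunif : ∀ S : Set (ℂ × ℂ), S ⊆ cyclicAnnulus K → IsCompact S →
      ∃ u : ℕ → ℝ, Summable u ∧ ∀ n : ℕ, ∀ q ∈ S,
        ∑ i ∈ Finset.Icc (-(n : ℤ) + 1) ((n : ℤ) - 1), ‖α n i * minimalSolution n i q‖ ≤ u n := by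
    intro S hS hc
    obtain ⟨c, hc0, hcK, hcS⟩ := exists_hexSize_le_of_isCompact hK hS hc
    -- The coefficients decay like e^{-K'n} while the solutions grow on S at most like e^{cn}, so
    -- any K' strictly between c and K gives a summable bound.
    obtain ⟨K', h1, h2⟩ := exists_between hcK
    obtain ⟨D, -, -, -, hα⟩ := hbound K' (hc0.trans h1) h2
    refine ⟨_, summable_blockBound (D := D) (ρ := Real.exp (-K')) (c := c) (by positivity) ?_,
      fun n q hq => sum_norm_block_le hα (cyclicAnnulus_ne_zero (hS hq)).1
        (cyclicAnnulus_ne_zero (hS hq)).2 (hcS q hq) n⟩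
    rw [← Real.exp_add]
    simpa using h1
  have hpoint : ∀ q ∈ cyclicAnnulus K,
      Tendsto (fun N => minimalPartialSum α N q) atTop (nhds (M q)) := by
    intro q hq
    have h0 := cyclicAnnulus_ne_zero hq
    obtain ⟨K', h1, h2⟩ := exists_between (hexSize_lt hq)
    have hK' := (hexSize_nonneg q).trans_lt h1
    obtain ⟨C, hC, ha⟩ := exists_norm_laurentCoeff_le hK' h2 hd
    have hρ := hexp K' hK'
    have hρ0 := (Real.exp_pos (-K')).le
    obtain ⟨D, -, hP, hQ, -⟩ := hbound K' hK' h2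
    have hout : Tendsto (outerBlock P Q fun p => laurentMonomial p q) atTop (nhds 0) := by
      refine squeeze_zero_norm (norm_outerBlock_le hP hQ h0.1 h0.2 le_rfl) ?_
      have hr : Real.exp (-K') * Real.exp (hexSize q) < 1 := by
        rw [← Real.exp_add]
        simpa using h1
      -- `norm_outerBlock_le` has the constant 6D where `summable_blockBound` has 12D; hence D / 2.
      simpa using (summable_blockBound (D := D / 2) (by positivity) hr).tendsto_atTop_zero.congr
        fun n => by ring
    rw [← tendsto_add_atTop_iff_nat 1]
    have hlim := (tendsto_sum_hexBall (hasSum_laurent hK hd hq)).add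
      (hout.comp (tendsto_add_atTop_nat 1))
    rw [add_zero] at hlim
    refine hlim.congr fun N => ?_
    have := sum_blocks_eq (a := a) (P := P) (Q := Q) (fun p => laurentMonomial p q) hsw
      (coeff_right hC hρ0 hρ ha) (coeff_lower hC hρ0 hρ ha) (coeff_left hC hρ0 hρ ha hsw hrel)
      (coeffTwo_zero a) (coeffOne_neg_one a) (coeffOne_eq_coeffTwo hC hρ0 hρ ha hsw hrel) N
    simp only [minimalPartialSum, α, sum_minimalCoeff_eq_blocks]
    exact this.symm
  have hconv : MinimalSeriesConverges K α M := by
    intro S hS hc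
    obtain ⟨u, hu, hle⟩ := hunif S hS hc
    have h := tendstoUniformlyOn_sum_Icc (f := fun n q =>
      ∑ i ∈ Finset.Icc (-(n : ℤ) + 1) ((n : ℤ) - 1), α n i * minimalSolution n i q) (by simp) hu
      fun n q hq => (norm_sum_le _ _).trans (hle n q hq)
    -- The Weierstrass test gives some uniform limit; the pointwise limit identifies it as M.
    exact h.congr_right fun q hq =>
      tendsto_nhds_unique (h.tendsto_at hq) (hpoint q (hS hq))
  refine ⟨α, hconv, fun S hS hc => ?_, fun K' h0 h1 => ?_,
    fun β hβ n i hi => minimalSeries_coeff_unique hK hconv hβ n i hi⟩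
  · obtain ⟨u, hu, hle⟩ := hunif S hS hc
    refine ⟨_, tendstoUniformlyOn_sum_Icc (f := fun n q =>
      ∑ i ∈ Finset.Icc (-(n : ℤ) + 1) ((n : ℤ) - 1), ‖α n i * minimalSolution n i q‖) (by simp) hu
      fun n q hq => ?_⟩
    rw [Real.norm_of_nonneg (Finset.sum_nonneg fun _ _ => norm_nonneg _)]
    exact hle n q hq
  · obtain ⟨D, hD, -, -, hα⟩ := hbound K' h0 h1
    -- D may be 0, and a positive constant is required.
    refine ⟨D + 1, by positivity, fun n i _ => (hα n i).trans ?_⟩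
    rw [← Real.exp_nat_mul, mul_comm (n : ℝ)]
    exact mul_le_mul_of_nonneg_right (by linarith) (Real.exp_pos _).le
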